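/- Let $A=\begin{bmatrix}0&I_3\\0&0\end{bmatrix}$, $\Pi=\begin{bmatrix}-I_3&0\\0&I_3\end{bmatrix}$, $Q=\begin{bmatrix}0&I_3\\I_3&0\end{bmatrix}$, $H=\begin{bmatrix}I_3&0\\0&0\end{bmatrix}\in\mathbb{R}^{6\times 6}$, $B=\begin{bmatrix}0\\I_3\end{bmatrix}\in\mathbb{R}^{6\times 3}$ and $\Omega=\{\xi\in\mathbb{R}^6:\ \xi^\top H^\top H\xi=\pi^2,\ \xi^\top Q\xi>0\}$. *Controller.* Let $\rho>0$ and $-1\le\mu\le 1/\tilde n$, where $\tilde n$ is the minimal natural number with $\operatorname{rank}[B,AB,\dots,A^{\tilde n-1}B]=6$ (so $\tilde n=2$). Let $G_0\in\mathbb{R}^{6\times6}$, $Y_0\in\mathbb{R}^{3\times 6}$ satisfy $AG_0-G_0A+BY_0=A$, $G_0B=0$; put $G_{\mathbf d}=I_6+\mu G_0$, $A_0=A+BY_0(G_0-I_6)^{-1}$. Let $X\in\mathbb{R}^{6\times 6}$, $Y\in\mathbb{R}^{3\times 6}$ satisfy $$A_0X+XA_0^\top+BY+Y^\top B^\top+\rho(G_{\mathbf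 d}X+XG_{\mathbf d}^\top)=0,\quad G_{\mathbf d}X+XG_{\mathbf d}^\top\succ0,\quad X=X^\top\succ0 .$$ Put $K=YX^{-1}$, $P=X^{-1}$, $\mathbf d(s)=e^{sG_{\mathbf d}}$; let $\|0\|_{\mathbf d}=0$ and, for $x\ne0$, $\|x\|_{\mathbf d}=e^{s}$, where $s\in\mathbb{R}$ is such that $y=\mathbf d(-s)x$ satisfies $\sqrt{y^\top Py}=1$. Let $$u_{hom}(\xi)=\|\xi\|_{\mathbf d}^{1+\mu}\,K\,\mathbf d(-\ln\|\xi\|_{\mathbf d})\,\xi,\quad \xi\ne 0,\qquad u_{hom}(0)=0 .$$ *System.* For $\delta=(\delta_1,\delta_2)\in L^\infty((0,\infty),\mathbb{R}^{12})$ ($\delta_1$ is a measurement noise, $\delta_2$ an exogenous perturbation), consider $$\dot\xi=A\xi+Bu_{hom}(\xi+\delta_1)+\delta_2\ \text{ if }\xi^-\notin\Omega,\qquad \xi=\Pi\xi^-\ \text{ if }\xi^-\in\Omega,\qquad \xi(0)=\xi_0,$$ where $\xi^-(t)$ is the left limit of $\xi$ at $t$. A solution on $[0,T)$, $0<T\le\infty$,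 is a right-continuous function with left limits on $(0,T)$ whose jump times do not accumulate in $[0,T)$, which satisfies the reset equation at each jump time, and which is a Carathéodory solution of the differential equation between jumps. *Claim.* If $\mu I_6+G_{\mathbf d}$ is anti-Hurwitz (all its eigenvalues have positive real part), then this system is locally input-to-state stable with respect to $\delta=(\delta_1,\delta_2)$: there exist $\beta\in\mathcal{KL}$, $\gamma\in\mathcal K$, $r_x>0$ and $r_\delta>0$ such that for all $\xi_0\in\mathbb{R}^6$ with $\|\xi_0\|<r_x$ and all $\delta\in L^\infty$ with $\|\delta\|_{L^\infty}<r_\delta$ a solution on $[0,\infty)$ exists, every solution on an interval $[0,T)$ extends to a solution on $[0,\infty)$, and every solution satisfies $$\|\xi(t)\|\le\beta(\|\xi_0\|,t)+\gamma\big(\|\delta\|_{L^\infty((0,t),\mathbb{R}^{12})}\big)\qquad\text{for all } t\ge0\text{ in its interval of definition}.$$ Here $\mathcal K$ is the class of continuous strictly increasing $\alpha:\mathbb{R}_+\to\mathbb{R}_+$ with $\alpha(0)=0$, and $\mathcal{KL}$ is the class of continuous $\beta:\mathbb{R}_+\times\mathbb{R}_+\to\mathbb{R}_+$ with $\beta(\cdot,s)\in\mathcal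 K$ for each $s\ge 0$ and $\beta(r,\cdot)$ strictly decreasing to zero for each $r>0$. -/

import Mathlib

noncomputable section

namespace ImpulsiveAttitude

open Matrix MeasureTheory Set Filter Topology
open scoped NNReal ENNReal

section LinearAlgebra

variable {n m : Type} [Fintype n] [DecidableEq n] [Fintype m] [DecidableEq m]

/-- Action of a real matrix on Euclidean vectors. -/
def act (M : Matrix m n ℝ) (x : EuclideanSpace ℝ n) : EuclideanSpace ℝ m :=
  WithLp.toLp 2 (M *ᵥ x.ofLp)

/-- All complex eigenvalues have negative real part. -/
def IsHurwitz (G : Matrix n n ℝ) : Prop :=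
  ∀ z ∈ spectrum ℂ (G.map (algebraMap ℝ ℂ)), z.re < 0

def IsAntiHurwitz (G : Matrix n n ℝ) : Prop :=
  IsHurwitz (-G)

/-- The linear dilation `s ↦ e^{sG}` generated by `G`. -/
def dilation (G : Matrix n n ℝ) (s : ℝ) : Matrix n n ℝ :=
  NormedSpace.exp (s • G)

/-- The weighted Euclidean norm `√(xᵀ P x)`. -/
def weightedNorm (P : Matrix n n ℝ) (x : EuclideanSpace ℝ n) : ℝ :=
  Real.sqrt (x.ofLp ⬝ᵥ (P *ᵥ x.ofLp))

open Classical in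
/-- The canonical homogeneous norm of the dilation generated by `G`, induced by the norm
`√(xᵀ P x)`: it is `0` at `0`, and `e^s` with `‖e^{-sG} x‖_P = 1` at `x ≠ 0`
(such an `s` exists and is unique whenever the dilation is monotone for this norm). -/
def homNorm (P G : Matrix n n ℝ) (x : EuclideanSpace ℝ n) : ℝ :=
  if h : x ≠ 0 ∧ ∃ s : ℝ, weightedNorm P (act (dilation G (-s)) x) = 1 then
    Real.exp h.2.choose
  else 0

/-- The Kalman block matrix `[B, AB, …, A^{k-1}B]`. -/
def kalmanMatrix (A : Matrix n n ℝ) (B : Matrix n m ℝ) (k : ℕ) : Matrix n (Fin k × m) ℝ :=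
  Matrix.of fun i p => (A ^ (p.1 : ℕ) * B) i p.2

/-- The minimal `k` such that `[B, AB, …, A^{k-1}B]` has full row rank
(meaningful for controllable pairs). -/
def controllabilityIndex (A : Matrix n n ℝ) (B : Matrix n m ℝ) : ℕ :=
  sInf {k : ℕ | (kalmanMatrix A B k).rank = Fintype.card n}

/-- The generator `I + μ G₀` of the dilation. -/
def generator (μ : ℝ) (G₀ : Matrix n n ℝ) : Matrix n n ℝ :=
  1 + μ • G₀

/-- `(G₀, Y₀, X, Y)` are parameters of a homogeneous stabilizer of degree `μ` and rate `ρ` for the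
pair `(A, B)`. -/
structure IsHomogeneousDesign (A : Matrix n n ℝ) (B : Matrix n m ℝ) (μ ρ : ℝ)
    (G₀ : Matrix n n ℝ) (Y₀ : Matrix m n ℝ) (X : Matrix n n ℝ) (Y : Matrix m n ℝ) : Prop where
  degree_ge : -1 ≤ μ
  degree_le : μ ≤ 1 / (controllabilityIndex A B : ℝ)
  rate_pos : 0 < ρ
  generator_eq : A * G₀ - G₀ * A + B * Y₀ = A
  generator_input : G₀ * B = 0
  lyapunov_eq :
    (A + B * Y₀ * (G₀ - 1)⁻¹) * X + X * (A + B * Y₀ * (G₀ - 1)⁻¹)ᵀ + B * Y + Yᵀ * Bᵀ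
      + ρ • (generator μ G₀ * X + X * (generator μ G₀)ᵀ) = 0
  monotone : (generator μ G₀ * X + X * (generator μ G₀)ᵀ).PosDef
  posDef : X.PosDef

/-- The homogeneous feedback `‖x‖_d^{1+μ} K d(-ln ‖x‖_d) x`, with `K = Y X⁻¹` and `‖·‖_d` induced by
the norm weighted with `P = X⁻¹`. -/
def homFeedback (μ : ℝ) (G X : Matrix n n ℝ) (Y : Matrix m n ℝ) (x : EuclideanSpace ℝ n) :
    EuclideanSpace ℝ m :=
  (homNorm X⁻¹ G x) ^ (1 + μ) •
    act (Y * X⁻¹) (act (dilation G (-Real.log (homNorm X⁻¹ G x))) x)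

end LinearAlgebra

section Impulsive

variable {E W : Type} [NormedAddCommGroup E] [NormedSpace ℝ E] [NormedAddCommGroup W]

/-- `x` is, on `[0, T)`, a right-continuous solution with `x(0) = x₀` of the impulsive system
`ẋ = f(t, x)` while `x⁻ ∉ Ω`, `x = Φ(x⁻)` when `x⁻ ∈ Ω`, where `x⁻` is the left limit.
Jump times do not accumulate inside `[0, T)`, and between jumps `x` solves the differential equation
in the sense of Carathéodory (integral form). -/
structure IsImpulsiveSolution (f : ℝ → E → E) (Ω : Set E) (Φ : E → E) (x₀ : E) (T : EReal)
    (x : ℝ → E) : Prop where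
  init : x 0 = x₀
  right_cont : ∀ t : ℝ, 0 ≤ t → (t : EReal) < T → ContinuousWithinAt x (Ici t) t
  left_lim : ∀ t : ℝ, 0 < t → (t : EReal) < T → ∃ y, Tendsto x (𝓝[<] t) (𝓝 y)
  finite_jumps : ∀ t : ℝ, 0 ≤ t → (t : EReal) < T →
    {s : ℝ | s ∈ Ioc 0 t ∧ Function.leftLim x s ∈ Ω}.Finite
  jump : ∀ t : ℝ, 0 < t → (t : EReal) < T → Function.leftLim x t ∈ Ω →
    x t = Φ (Function.leftLim x t)
  flow : ∀ a b : ℝ, 0 ≤ a → a ≤ b → (b : EReal) < T →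
    (∀ s ∈ Ioc a b, Function.leftLim x s ∉ Ω) →
      IntervalIntegrable (fun s => f s (x s)) volume a b ∧
        x b = x a + ∫ s in a..b, f s (x s)

/-- Class `𝓚`. -/
def IsClassK (α : ℝ≥0 → ℝ≥0) : Prop :=
  Continuous α ∧ StrictMono α ∧ α 0 = 0

/-- Class `𝓚𝓛`. -/
def IsClassKL (β : ℝ≥0 → ℝ≥0 → ℝ≥0) : Prop :=
  Continuous (Function.uncurry β) ∧ (∀ s, IsClassK fun r => β r s) ∧
    ∀ r, 0 < r → StrictAnti (β r) ∧ Tendsto (β r) atTop (𝓝 0)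

/-- The norm of `δ` in `L^∞(S)`. -/
def supNorm (δ : ℝ → W) (S : Set ℝ) : ℝ≥0 :=
  (eLpNorm δ ∞ (volume.restrict S)).toNNReal

/-- Local input-to-state stability of the impulsive system `ẋ = f(x, δ)` for `x⁻ ∉ Ω`, `x = Φ(x⁻)`
for `x⁻ ∈ Ω`: for small initial states and small inputs `δ ∈ L^∞(0, ∞)` there is a solution on
`[0, ∞)`, and every solution obeys the estimate and extends to a solution on `[0, ∞)`. -/
def IsLocallyISS (f : E → W → E) (Ω : Set E) (Φ : E → E) : Prop :=
  ∃ (β : ℝ≥0 → ℝ≥0 → ℝ≥0) (γ : ℝ≥0 → ℝ≥0), IsClassKL β ∧ IsClassK γ ∧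
    ∃ rx : ℝ≥0, 0 < rx ∧ ∃ rδ : ℝ≥0, 0 < rδ ∧ ∀ x₀ : E, ‖x₀‖₊ < rx →
      ∀ δ : ℝ → W, MemLp δ ∞ (volume.restrict (Ioi 0)) → supNorm δ (Ioi 0) < rδ →
        (∃ x, IsImpulsiveSolution (fun t y => f y (δ t)) Ω Φ x₀ ⊤ x) ∧
        ∀ T : EReal, 0 < T → ∀ x, IsImpulsiveSolution (fun t y => f y (δ t)) Ω Φ x₀ T x →
          (∀ t : ℝ≥0, ((t : ℝ) : EReal) < T →
            ‖x t‖₊ ≤ β ‖x₀‖₊ t + γ (supNorm δ (Ioo 0 (t : ℝ)))) ∧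
          ∃ y, IsImpulsiveSolution (fun t y => f y (δ t)) Ω Φ x₀ ⊤ y ∧
            ∀ t : ℝ, 0 ≤ t → (t : EReal) < T → y t = x t

end Impulsive

section Attitude

/-- Indices of `ξ = (θ, θ̇) ∈ ℝ³ × ℝ³ = ℝ⁶`. -/
abbrev Ix : Type := Fin 3 ⊕ Fin 3

abbrev State : Type := EuclideanSpace ℝ Ix

/-- Values `δ = (δ₁, δ₂) ∈ ℝ⁶ × ℝ⁶ = ℝ¹²`, with the Euclidean norm. -/
abbrev Disturbance : Type := WithLp 2 (State × State)

def matA : Matrix Ix Ix ℝ := fromBlocks 0 1 0 0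

def matB : Matrix Ix (Fin 3) ℝ := fromRows 0 1

/-- The reset matrix `(θ, θ̇) ↦ (-θ, θ̇)`. -/
def matPi : Matrix Ix Ix ℝ := fromBlocks (-1) 0 0 1

def matQ : Matrix Ix Ix ℝ := fromBlocks 0 1 1 0

def matH : Matrix Ix Ix ℝ := fromBlocks 1 0 0 0

/-- The jump set. -/
def jumpSet : Set State :=
  {ξ | ξ.ofLp ⬝ᵥ ((matHᵀ * matH) *ᵥ ξ.ofLp) = Real.pi ^ 2 ∧ 0 < ξ.ofLp ⬝ᵥ (matQ *ᵥ ξ.ofLp)}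

/-- The perturbed closed-loop vector field `Aξ + B u(ξ + δ₁) + δ₂`. -/
def perturbedField (u : State → EuclideanSpace ℝ (Fin 3)) (ξ : State) (δ : Disturbance) : State :=
  act matA ξ + act matB (u (ξ + δ.fst)) + δ.snd

end Attitude

end ImpulsiveAttitude

end

/-! The equations for `G₀` and `Y₀` leave no freedom: comparing blocks gives `G₀ = diag(-1, 0)` and
`Y₀ = 0`. The dilation is therefore diagonal, with weight `1 - μ` on angles and `1` on velocities,
and positivity together with the anti-Hurwitz condition forces `-1 < μ < 1`.

With `P = X⁻¹`, the Lyapunov equation compares the closed-loop field on the `P`-unit sphere with the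
generator of the dilation (`inner_closedLoop`). By homogeneity of degree `μ`, the homogeneous norm
`v` of an unperturbed solution satisfies `v' = -ρ v ^ (1 + μ)`. The feedback is continuous and the
sphere compact, so half of this rate survives noise and perturbations of size `η v²` at scales `v ≤
1` (`exists_robustnessMargin`). There `v ^ (1 + μ) ≥ v²`, so a solution cannot leave the tube of
homogeneous radius `v₀ / (1 + (ρ/4) v₀ t) + χ` when the disturbance is at most `η χ²`
(`quad_scale_envelope_le_one`). Translated to the Euclidean norm, the two summands become `β` and
`γ` (`exists_flow_estimate`).

Points of the jump set have norm at least `π`, while small solutions stay in the unit ball, so they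
never jump and only an ordinary differential equation remains. Its field is merely continuous in the
state, so uniqueness is not available: the estimate is proved for every solution, and existence and
extension come from a Carathéodory–Peano theorem applied to the field truncated outside the unit
ball (`isLocallyISS_of_flow_estimate`). -/

noncomputable section

open Matrix MeasureTheory Set Filter Topology
open scoped NNReal ENNReal

namespace ImpulsiveAttitude

/-! ### Existence for Carathéodory differential equations via Euler polygons -/

section Caratheodory

variable {E W : Type} [NormedAddCommGroup E] [NormedSpace ℝ E] [NormedAddCommGroup W]

/-- Equi-Lipschitz maps on the line that agree at a point have a pointwise convergent
subsequence. -/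
theorem exists_subseq_tendsto_of_lipschitz [FiniteDimensional ℝ E] {M t₀ : ℝ} {x₀ : E}
    (z : ℕ → ℝ → E) (h₀ : ∀ k, z k t₀ = x₀)
    (hz : ∀ k s t, ‖z k t - z k s‖ ≤ M * |t - s|) :
    ∃ φ : ℕ → ℕ, StrictMono φ ∧ ∃ y : ℝ → E, ∀ t, Tendsto (fun k => z (φ k) t) atTop (𝓝 (y t)) := by
  have : ProperSpace E := FiniteDimensional.proper ℝ E
  have : CompleteSpace E := FiniteDimensional.complete ℝ E
  -- Tychonoff on the rationals replaces the diagonal argument; the common Lipschitz constant then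
  -- carries convergence to all real times.
  have hK : IsCompact (Set.pi univ fun q : ℚ => Metric.closedBall x₀ (M * |(q : ℝ) - t₀|)) :=
    isCompact_univ_pi fun q => isCompact_closedBall _ _
  obtain ⟨a, -, φ, hφ, hlim⟩ := hK.tendsto_subseq (x := fun k (q : ℚ) => z k q) (by
    intro k q _
    rw [Metric.mem_closedBall, dist_eq_norm, ← h₀ k]
    exact hz k t₀ q)
  rw [tendsto_pi_nhds] at hlim
  have hM : 0 ≤ M := by
    have := (norm_nonneg _).trans (hz 0 0 1)
    simpa using this
  refine ⟨φ, hφ, ?_⟩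
  suffices ∀ t, CauchySeq fun k => z (φ k) t by
    choose y hy using fun t => cauchySeq_tendsto_of_complete (this t)
    exact ⟨y, hy⟩
  intro t
  rw [Metric.cauchySeq_iff']
  intro ε hε
  obtain ⟨q, hq₁, hq₂⟩ := exists_rat_btwn (show t < t + ε / (3 * (M + 1)) by
    have : 0 < ε / (3 * (M + 1)) := by positivity
    linarith)
  have hq : M * |t - q| < ε / 3 := by
    rw [abs_sub_comm, abs_of_pos (by linarith)]
    have h1 : (q : ℝ) - t < ε / (3 * (M + 1)) := by linarith
    calc M * (q - t) ≤ (M + 1) * (q - t) := by nlinarith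
      _ < (M + 1) * (ε / (3 * (M + 1))) := by gcongr
      _ = ε / 3 := by field_simp
  obtain ⟨N, hN⟩ := Metric.cauchySeq_iff'.1 (hlim q).cauchySeq (ε / 3) (by positivity)
  refine ⟨N, fun k hk => ?_⟩
  have h1 := hN k hk
  simp only [Function.comp_apply] at h1
  have h2 := hz (φ k) q t
  have h3 := hz (φ N) q t
  rw [dist_eq_norm] at h1 ⊢
  calc ‖z (φ k) t - z (φ N) t‖
      = ‖(z (φ k) t - z (φ k) q) + (z (φ k) q - z (φ N) q) - (z (φ N) t - z (φ N) q)‖ := by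
        congr 1; abel
    _ ≤ ‖z (φ k) t - z (φ k) q‖ + ‖z (φ k) q - z (φ N) q‖ + ‖z (φ N) t - z (φ N) q‖ := by
        refine (norm_sub_le _ _).trans ?_
        gcongr
        exact norm_add_le _ _
    _ < ε := by linarith

theorem intervalIntegrable_of_ae_bound {E : Type} [NormedAddCommGroup E] {g : ℝ → E} {M : ℝ}
    (hg : AEStronglyMeasurable g volume) (hM : ∀ᵐ s, ‖g s‖ ≤ M) (a b : ℝ) :
    IntervalIntegrable g volume a b := by
  rw [intervalIntegrable_iff]
  exact Measure.integrableOn_of_bounded (M := M) (by simp) hg (ae_restrict_of_ae hM)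

/-- An essentially bounded measurable function on the line has a Lipschitz primitive. -/
theorem norm_integral_sub_le_of_ae_bound {g : ℝ → E} {M : ℝ}
    (hg : AEStronglyMeasurable g volume) (hM : ∀ᵐ s, ‖g s‖ ≤ M) (t₀ s t : ℝ) :
    ‖(∫ r in t₀..t, g r) - ∫ r in t₀..s, g r‖ ≤ M * |t - s| := by
  rw [intervalIntegral.integral_interval_sub_left
    (intervalIntegrable_of_ae_bound hg hM _ _) (intervalIntegrable_of_ae_bound hg hM _ _)]
  exact intervalIntegral.norm_integral_le_of_norm_le_const_ae
    (by filter_upwards [hM] with r hr _ using hr)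

/-- Euler polygons with step `h` for a field that is measurable in time. -/
theorem exists_euler_polygon {g : ℝ → E → E} {M t₀ : ℝ} {x₀ : E} {h : ℝ} (hh : 0 < h)
    (hmeas : ∀ p : ℝ → E, StronglyMeasurable p → AEStronglyMeasurable (fun s => g s (p s)) volume)
    (hM : ∀ᵐ s, ∀ x, ‖g s x‖ ≤ M) :
    ∃ p : ℝ → E, StronglyMeasurable p ∧
      ∀ s, t₀ ≤ s → ‖p s - (x₀ + ∫ r in t₀..s, g r (p r))‖ ≤ M * h := by
  let v : ℕ → E := fun j => Nat.rec x₀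
    (fun j y => y + ∫ r in (t₀ + j * h)..(t₀ + (j + 1 : ℕ) * h), g r y) j
  have hv : ∀ j, v (j + 1) = v j + ∫ r in (t₀ + j * h)..(t₀ + (j + 1 : ℕ) * h), g r (v j) :=
    fun j => rfl
  let p : ℝ → E := fun s => v ⌊(s - t₀) / h⌋₊
  -- The polygon is sampled as a step function, so measurability of `g s (p s)` is immediate; it
  -- differs from the true primitive by at most `M * h`.
  have hp : StronglyMeasurable p := by
    have h1 : StronglyMeasurable v := StronglyMeasurable.of_discrete
    exact h1.comp_measurable (Nat.measurable_floor.comp (by fun_prop))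
  have hpM : ∀ᵐ s, ‖g s (p s)‖ ≤ M := by filter_upwards [hM] with s hs using hs _
  have hint := intervalIntegrable_of_ae_bound (hmeas p hp) hpM
  have hnode : ∀ j : ℕ, x₀ + ∫ r in t₀..(t₀ + j * h), g r (p r) = v j := by
    intro j
    induction j with
    | zero => simp [v]
    | succ j ih =>
      rw [← intervalIntegral.integral_add_adjacent_intervals (hint t₀ (t₀ + j * h)) (hint _ _),
        ← add_assoc, ih, hv]
      congr 1
      have hle : t₀ + j * h ≤ t₀ + (j + 1 : ℕ) * h := by push_cast; nlinarith
      -- The right endpoint must be dropped: the floor already equals `j + 1` there.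
      rw [intervalIntegral.integral_of_le hle, intervalIntegral.integral_of_le hle,
        integral_Ioc_eq_integral_Ioo, integral_Ioc_eq_integral_Ioo]
      refine setIntegral_congr_fun measurableSet_Ioo fun r hr => ?_
      have : ⌊(r - t₀) / h⌋₊ = j := by
        have h0 : 0 ≤ (j : ℝ) * h := by positivity
        rw [Nat.floor_eq_iff (div_nonneg (by linarith [hr.1]) hh.le)]
        have h1 := hr.1
        have h2 := hr.2
        push_cast at h2
        constructor
        · rw [le_div_iff₀ hh]; linarith
        · rw [div_lt_iff₀ hh]; linarith
      simp only [p, this]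
  refine ⟨p, hp, fun s hs => ?_⟩
  have hM0 : 0 ≤ M := by
    obtain ⟨r, hr⟩ := hM.exists
    exact (norm_nonneg _).trans (hr 0)
  have hs0 : 0 ≤ (s - t₀) / h := div_nonneg (by linarith) hh.le
  have h1 := Nat.floor_le hs0
  have h2 := Nat.lt_floor_add_one ((s - t₀) / h)
  rw [le_div_iff₀ hh] at h1
  rw [div_lt_iff₀ hh] at h2
  have h3 : p s = x₀ + ∫ r in t₀..(t₀ + (⌊(s - t₀) / h⌋₊ : ℕ) * h), g r (p r) := (hnode _).symm
  rw [h3, add_sub_add_left_eq_sub]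
  refine (norm_integral_sub_le_of_ae_bound (hmeas p hp) hpM _ _ _).trans ?_
  gcongr
  rw [abs_sub_comm, abs_of_nonneg (by linarith)]
  linarith

/-- Peano's existence theorem in Carathéodory's setting, for a field `F (x, δ t)` that is bounded
along the input `δ`. -/
theorem exists_forward_solution [FiniteDimensional ℝ E] {F : E → W → E} {δ : ℝ → W} {M t₀ : ℝ}
    (x₀ : E) (hF : Continuous (Function.uncurry F))
    (hδ : AEStronglyMeasurable δ (volume.restrict (Ioi t₀)))
    (hM : ∀ᵐ s ∂(volume.restrict (Ioi t₀)), ∀ x, ‖F x (δ s)‖ ≤ M) :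
    ∃ z : ℝ → E, Continuous z ∧
      ∀ t, t₀ ≤ t → IntervalIntegrable (fun s => F (z s) (δ s)) volume t₀ t ∧
        z t = x₀ + ∫ s in t₀..t, F (z s) (δ s) := by
  have : CompleteSpace E := FiniteDimensional.complete ℝ E
  -- Extending the field by zero to the left of `t₀` makes the bound hold almost everywhere on the
  -- whole line.
  let g : ℝ → E → E := fun s x => (Ioi t₀).indicator (fun s => F x (δ s)) s
  have hgI : ∀ s ∈ Ioi t₀, ∀ x, g s x = F x (δ s) := fun s hs x => indicator_of_mem hs _
  have hM0 : 0 ≤ M := by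
    have : (ae (volume.restrict (Ioi t₀))).NeBot := by
      rw [ae_neBot, Ne, Measure.restrict_eq_zero]; simp
    obtain ⟨r, hr⟩ := hM.exists
    exact (norm_nonneg _).trans (hr 0)
  have hgM : ∀ᵐ s, ∀ x, ‖g s x‖ ≤ M := by
    rw [ae_restrict_iff' measurableSet_Ioi] at hM
    filter_upwards [hM] with s hs x
    by_cases h : s ∈ Ioi t₀
    · rw [hgI s h]; exact hs h x
    · simp only [g, indicator_of_notMem h, norm_zero, hM0]
  have hgmeas : ∀ p : ℝ → E, StronglyMeasurable p →
      AEStronglyMeasurable (fun s => g s (p s)) volume := by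
    intro p hp
    have : AEStronglyMeasurable (fun s => F (p s) (δ s)) (volume.restrict (Ioi t₀)) :=
      hF.comp_aestronglyMeasurable (hp.aestronglyMeasurable.prodMk hδ)
    exact (aestronglyMeasurable_indicator_iff measurableSet_Ioi).2 this
  choose p hp hpe using fun k : ℕ =>
    exists_euler_polygon (g := g) (t₀ := t₀) (x₀ := x₀) (Nat.one_div_pos_of_nat (α := ℝ) (n := k))
      hgmeas hgM
  have hpM : ∀ k, ∀ᵐ s, ‖g s (p k s)‖ ≤ M := fun k => by
    filter_upwards [hgM] with s hs using hs _
  obtain ⟨φ, hφ, z, hz⟩ := exists_subseq_tendsto_of_lipschitz (M := M) (t₀ := t₀) (x₀ := x₀)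
    (fun k t => x₀ + ∫ r in t₀..t, g r (p k r)) (by simp) (fun k s t => by
      rw [add_sub_add_left_eq_sub]
      exact norm_integral_sub_le_of_ae_bound (hgmeas _ (hp k)) (hpM k) _ _ _)
  have hzc : Continuous z := by
    have : LipschitzWith ⟨M, hM0⟩ z := by
      refine LipschitzWith.of_dist_le_mul fun t s => ?_
      rw [dist_eq_norm]
      refine le_of_tendsto ((hz t).sub (hz s)).norm (Eventually.of_forall fun k => ?_)
      rw [add_sub_add_left_eq_sub, Real.dist_eq]
      exact norm_integral_sub_le_of_ae_bound (hgmeas _ (hp _)) (hpM _) _ _ _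
    exact this.continuous
  have hpz : ∀ s, t₀ ≤ s → Tendsto (fun k => p (φ k) s) atTop (𝓝 (z s)) := by
    intro s hs
    -- The step functions and their primitives differ by at most `M / (φ k + 1)`, so both have the
    -- limit `z`.
    have h1 : Tendsto (fun k => p (φ k) s - (x₀ + ∫ r in t₀..s, g r (p (φ k) r))) atTop (𝓝 0) := by
      refine squeeze_zero_norm (fun k => hpe (φ k) s hs) ?_
      have := (tendsto_one_div_add_atTop_nhds_zero_nat (𝕜 := ℝ)).comp hφ.tendsto_atTop
      simpa using this.const_mul M
    simpa using h1.add (hz s)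
  have hgz : ∀ t, t₀ ≤ t → EqOn (fun s => g s (z s)) (fun s => F (z s) (δ s)) (uIoc t₀ t) := by
    intro t ht s hs
    rw [uIoc_of_le ht] at hs
    exact hgI s hs.1 _
  refine ⟨z, hzc, fun t ht => ⟨?_, ?_⟩⟩
  · refine IntervalIntegrable.congr (hgz t ht) ?_
    exact intervalIntegrable_of_ae_bound (hgmeas z hzc.stronglyMeasurable)
      (by filter_upwards [hgM] with s hs using hs _) _ _
  · rw [← intervalIntegral.integral_congr_ae (Eventually.of_forall (hgz t ht))]
    refine tendsto_nhds_unique (hz t) (tendsto_const_nhds.add ?_)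
    refine intervalIntegral.tendsto_integral_filter_of_dominated_convergence (fun _ => M)
      (Eventually.of_forall fun k => (hgmeas _ (hp _)).restrict)
      (Eventually.of_forall fun k => by filter_upwards [hpM (φ k)] with s hs _ using hs)
      intervalIntegrable_const (Eventually.of_forall fun s hs => ?_)
    rw [uIoc_of_le ht] at hs
    simp only [hgI s hs.1]
    exact (hF.comp (by fun_prop : Continuous fun x : E => (x, δ s))).continuousAt.tendsto.comp
      (hpz s hs.1.le)

end Caratheodory

/-! ### Matrix actions, quadratic forms and diagonal dilations -/

section Dilations

variable {n m : Type} [Fintype n] [Fintype m]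

/-- `act M` as a continuous linear map. -/
def actL (M : Matrix m n ℝ) : EuclideanSpace ℝ n →L[ℝ] EuclideanSpace ℝ m :=
  LinearMap.toContinuousLinearMap
    { toFun := act M
      map_add' := fun x y => by simp [act, mulVec_add]
      map_smul' := fun c x => by simp [act, mulVec_smul] }

theorem actL_apply (M : Matrix m n ℝ) (x : EuclideanSpace ℝ n) : actL M x = act M x := rfl

theorem ofLp_actL (M : Matrix m n ℝ) (x : EuclideanSpace ℝ n) :
    (actL M x).ofLp = M *ᵥ x.ofLp := rfl

theorem actL_mul {k : Type} [Fintype k] (M : Matrix k m ℝ) (N : Matrix m n ℝ)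
    (x : EuclideanSpace ℝ n) : actL (M * N) x = actL M (actL N x) := by
  ext i; simp [ofLp_actL]

theorem add_actL (M N : Matrix m n ℝ) (x : EuclideanSpace ℝ n) :
    actL (M + N) x = actL M x + actL N x := by
  ext i; simp [ofLp_actL, add_mulVec]

theorem smul_actL (c : ℝ) (M : Matrix m n ℝ) (x : EuclideanSpace ℝ n) :
    actL (c • M) x = c • actL M x := by
  ext i; simp [ofLp_actL, smul_mulVec]

theorem inner_actL (M : Matrix n n ℝ) (x y : EuclideanSpace ℝ n) :
    inner ℝ x (actL M y) = x.ofLp ⬝ᵥ M *ᵥ y.ofLp := by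
  rw [EuclideanSpace.inner_eq_star_dotProduct, dotProduct_comm]
  simp [ofLp_actL]

theorem inner_actL_transpose (M : Matrix n n ℝ) (x y : EuclideanSpace ℝ n) :
    inner ℝ x (actL Mᵀ y) = inner ℝ y (actL M x) := by
  rw [inner_actL, inner_actL, mulVec_transpose, dotProduct_mulVec, dotProduct_comm]

/-- The quadratic form `xᵀ P x`. -/
def quad (P : Matrix n n ℝ) (x : EuclideanSpace ℝ n) : ℝ := inner ℝ x (actL P x)

theorem continuous_quad (P : Matrix n n ℝ) : Continuous (quad P) :=
  continuous_id.inner (actL P).continuous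

theorem weightedNorm_eq_one_iff (P : Matrix n n ℝ) (x : EuclideanSpace ℝ n) :
    weightedNorm P x = 1 ↔ quad P x = 1 := by
  rw [weightedNorm, Real.sqrt_eq_one, quad, inner_actL]

theorem quad_pos {P : Matrix n n ℝ} (hP : P.PosDef) {x : EuclideanSpace ℝ n} (hx : x ≠ 0) :
    0 < quad P x := by
  rw [quad, inner_actL]
  have := hP.dotProduct_mulVec_pos (x := x.ofLp) (by simpa using hx)
  simpa using this

theorem quad_zero (P : Matrix n n ℝ) : quad P 0 = 0 := by simp [quad]

theorem quad_smul (P : Matrix n n ℝ) (c : ℝ) (x : EuclideanSpace ℝ n) :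
    quad P (c • x) = c ^ 2 * quad P x := by
  simp only [quad, map_smul, inner_smul_left, inner_smul_right, conj_trivial]; ring

theorem quad_le (P : Matrix n n ℝ) : ∃ C > 0, ∀ x, quad P x ≤ (C * ‖x‖) ^ 2 := by
  refine ⟨√(‖actL P‖ + 1), by positivity, fun x => ?_⟩
  rw [mul_pow, Real.sq_sqrt (by positivity)]
  calc quad P x ≤ ‖x‖ * ‖actL P x‖ := real_inner_le_norm _ _
    _ ≤ ‖x‖ * (‖actL P‖ * ‖x‖) := by gcongr; exact (actL P).le_opNorm x
    _ ≤ (‖actL P‖ + 1) * ‖x‖ ^ 2 := by nlinarith [sq_nonneg ‖x‖]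

/-- The minimum over the unit sphere is positive, and degree-two homogeneity spreads it to all
vectors. The sphere is empty when `n` is, which needs a separate case. -/
theorem le_quad {P : Matrix n n ℝ} (hP : P.PosDef) : ∃ c > 0, ∀ x, (c * ‖x‖) ^ 2 ≤ quad P x := by
  rcases (Metric.sphere (0 : EuclideanSpace ℝ n) 1).eq_empty_or_nonempty with h | h
  · refine ⟨1, one_pos, fun x => ?_⟩
    have : x = 0 := by
      by_contra hx
      have : ‖x‖⁻¹ • x ∈ Metric.sphere (0 : EuclideanSpace ℝ n) 1 := by
        simp [norm_smul, hx]
      rw [h] at this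
      exact this
    simp [this, quad_zero]
  · obtain ⟨y, hy, hmin⟩ := (isCompact_sphere (0 : EuclideanSpace ℝ n) 1).exists_isMinOn h
      (continuous_quad P).continuousOn
    have hy0 : y ≠ 0 := by
      rintro rfl
      simp at hy
    refine ⟨√(quad P y), Real.sqrt_pos.2 (quad_pos hP hy0), fun x => ?_⟩
    rw [mul_pow, Real.sq_sqrt (quad_pos hP hy0).le]
    rcases eq_or_ne x 0 with rfl | hx
    · simp [quad_zero]
    · have h1 : quad P y ≤ quad P (‖x‖⁻¹ • x) := hmin (by simp [norm_smul, hx])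
      rw [quad_smul] at h1
      have hx' : 0 < ‖x‖ := norm_pos_iff.2 hx
      calc quad P y * ‖x‖ ^ 2 ≤ (‖x‖⁻¹ ^ 2 * quad P x) * ‖x‖ ^ 2 := by gcongr
        _ = quad P x := by field_simp

theorem isCompact_quad_eq_one {P : Matrix n n ℝ} (hP : P.PosDef) :
    IsCompact {x : EuclideanSpace ℝ n | quad P x = 1} := by
  obtain ⟨c, hc, h⟩ := le_quad hP
  refine Metric.isCompact_of_isClosed_isBounded
    (isClosed_eq (continuous_quad P) continuous_const) ?_
  refine (Metric.isBounded_closedBall (x := 0) (r := 1 / c)).subset fun x hx => ?_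
  have h1 := h x
  rw [mem_ofPred_eq] at hx
  rw [hx] at h1
  rw [mem_closedBall_zero_iff, le_div_iff₀ hc]
  nlinarith [norm_nonneg x]

theorem inner_actL_comm {P : Matrix n n ℝ} (hP : P.PosDef) (x y : EuclideanSpace ℝ n) :
    inner ℝ x (actL P y) = inner ℝ (actL P x) y := by
  rw [real_inner_comm y, ← inner_actL_transpose]
  have : Pᵀ = P := by simpa using hP.isHermitian.eq
  rw [this]

theorem quad_add {P : Matrix n n ℝ} (hP : P.PosDef) (x y : EuclideanSpace ℝ n) :
    quad P (x + y) = quad P x + 2 * inner ℝ (actL P x) y + quad P y := by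
  simp only [quad, map_add, inner_add_left, inner_add_right, inner_actL_comm hP x y,
    real_inner_comm (actL P x) y]
  ring

theorem norm_le_mul_norm_of_coord_le {c : ℝ} (hc : 0 ≤ c) {x y : EuclideanSpace ℝ n}
    (h : ∀ i, |x i| ≤ c * |y i|) : ‖x‖ ≤ c * ‖y‖ := by
  rw [EuclideanSpace.norm_eq, EuclideanSpace.norm_eq, ← Real.sqrt_sq hc,
    ← Real.sqrt_mul (sq_nonneg c), Finset.mul_sum]
  refine Real.sqrt_le_sqrt (Finset.sum_le_sum fun i _ => ?_)
  rw [← mul_pow]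
  exact pow_le_pow_left₀ (norm_nonneg _) (h i) 2

variable [DecidableEq n]

/-- The diagonal dilation `x ↦ (v ^ wᵢ xᵢ)ᵢ` with weights `w`. -/
def scale (w : n → ℝ) (v : ℝ) : EuclideanSpace ℝ n →L[ℝ] EuclideanSpace ℝ n :=
  ∑ i, v ^ w i • actL (diagonal (Pi.single i 1))

theorem scale_apply (w : n → ℝ) (v : ℝ) (x : EuclideanSpace ℝ n) (i : n) :
    scale w v x i = v ^ w i * x i := by
  simp [scale, ofLp_actL, mulVec_diagonal, Pi.single_apply]

theorem scale_one (w : n → ℝ) (x : EuclideanSpace ℝ n) : scale w 1 x = x := by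
  ext i; simp [scale_apply]

theorem scale_scale (w : n → ℝ) {u v : ℝ} (hu : 0 < u) (hv : 0 < v) (x : EuclideanSpace ℝ n) :
    scale w u (scale w v x) = scale w (u * v) x := by
  ext i; simp [scale_apply, Real.mul_rpow hu.le hv.le, mul_assoc]

theorem scale_scale_inv (w : n → ℝ) {v : ℝ} (hv : 0 < v) (x : EuclideanSpace ℝ n) :
    scale w v (scale w v⁻¹ x) = x := by
  rw [scale_scale w hv (inv_pos.2 hv), mul_inv_cancel₀ hv.ne', scale_one]

theorem scale_inv_scale (w : n → ℝ) {v : ℝ} (hv : 0 < v) (x : EuclideanSpace ℝ n) :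
    scale w v⁻¹ (scale w v x) = x := by
  rw [scale_scale w (inv_pos.2 hv) hv, inv_mul_cancel₀ hv.ne', scale_one]

theorem scale_ne_zero (w : n → ℝ) {v : ℝ} (hv : 0 < v) {x : EuclideanSpace ℝ n} (hx : x ≠ 0) :
    scale w v x ≠ 0 := by
  intro h
  apply hx
  rw [← scale_inv_scale w hv x, h, map_zero]

/-- For `v ≤ 1` a contraction is governed by the smallest weight; the inverse expansion below is
governed by the largest. -/
theorem norm_scale_le_of_le_one {w : n → ℝ} {b v : ℝ} (hw : ∀ i, b ≤ w i) (hv : 0 < v)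
    (hv1 : v ≤ 1) (x : EuclideanSpace ℝ n) : ‖scale w v x‖ ≤ v ^ b * ‖x‖ := by
  refine norm_le_mul_norm_of_coord_le (by positivity) fun i => ?_
  rw [scale_apply, abs_mul, abs_of_pos (by positivity)]
  exact mul_le_mul_of_nonneg_right (Real.rpow_le_rpow_of_exponent_ge hv hv1 (hw i)) (abs_nonneg _)

theorem norm_scale_inv_le_of_le_one {w : n → ℝ} {p v : ℝ} (hw : ∀ i, w i ≤ p) (hv : 0 < v)
    (hv1 : v ≤ 1) (x : EuclideanSpace ℝ n) : ‖scale w v⁻¹ x‖ ≤ v⁻¹ ^ p * ‖x‖ := by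
  refine norm_le_mul_norm_of_coord_le (by positivity) fun i => ?_
  rw [scale_apply, abs_mul, abs_of_pos (by positivity)]
  gcongr
  · exact (one_le_inv₀ hv).2 hv1
  · exact hw i

theorem hasDerivAt_scale_inv (w : n → ℝ) {v : ℝ} (hv : 0 < v) :
    HasDerivAt (fun v => scale w v⁻¹) (-(v⁻¹ • (actL (diagonal w)).comp (scale w v⁻¹))) v := by
  have h : ∀ i, HasDerivAt (fun v : ℝ => v⁻¹ ^ w i) (-(v⁻¹ * (w i * v⁻¹ ^ w i))) v := fun i => by
    convert (hasDerivAt_inv hv.ne').rpow_const (p := w i) (Or.inl (inv_pos.2 hv).ne') using 1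
    rw [Real.rpow_sub_one (inv_pos.2 hv).ne']
    field_simp
  have h2 := HasDerivAt.fun_sum (u := Finset.univ) fun i (_ : i ∈ Finset.univ) =>
    (h i).smul_const (actL (diagonal (Pi.single i (1 : ℝ))))
  unfold scale
  refine h2.congr_deriv ?_
  ext x j
  simp [ofLp_actL, mulVec_diagonal, Pi.single_apply]
  ring

theorem continuousOn_scale_inv (w : n → ℝ) : ContinuousOn (fun v => scale w v⁻¹) (Ioi 0) :=
  fun _ hv => (hasDerivAt_scale_inv w hv).continuousAt.continuousWithinAt

theorem act_dilation_diagonal (w : n → ℝ) (s : ℝ) (x : EuclideanSpace ℝ n) :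
    act (dilation (diagonal w) s) x = scale w (Real.exp s) x := by
  ext i
  rw [scale_apply, dilation, ← diagonal_smul, exp_diagonal, act]
  simp only [mulVec_diagonal]
  rw [Pi.coe_exp, ← Real.exp_eq_exp_ℝ, ← Real.exp_mul]
  simp

end Dilations

/-! ### The canonical homogeneous norm and the homogeneous feedback -/

section HomogeneousNorm

variable {n m : Type} [Fintype n] [Fintype m] [DecidableEq n]

theorem homNorm_zero (P G : Matrix n n ℝ) : homNorm P G 0 = 0 := by
  simp [homNorm]

theorem homFeedback_zero (μ : ℝ) (G X : Matrix n n ℝ) (Y : Matrix m n ℝ) :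
    homFeedback μ G X Y 0 = 0 := by
  simp only [homFeedback, map_zero, ← actL_apply, smul_zero]

/-- The diagonal dilation with weights `w` is strictly monotone for the norm `√(xᵀ P x)`. -/
structure IsMonotoneDilation (P : Matrix n n ℝ) (w : n → ℝ) : Prop where
  posDef : P.PosDef
  weight_pos : ∃ b > 0, ∀ i, b ≤ w i
  mono : ∀ y : EuclideanSpace ℝ n, y ≠ 0 → 0 < inner ℝ (actL P y) (actL (diagonal w) y)

namespace IsMonotoneDilation

variable {P : Matrix n n ℝ} {w : n → ℝ}

/-- With `y = scale w v⁻¹ x`, the derivative in `v` is `-(2 / v)` times the inner product that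
`mono` makes positive. -/
theorem strictAntiOn (h : IsMonotoneDilation P w) {x : EuclideanSpace ℝ n} (hx : x ≠ 0) :
    StrictAntiOn (fun v => quad P (scale w v⁻¹ x)) (Ioi 0) := by
  have hd : ∀ v : ℝ, 0 < v → HasDerivAt (fun v => quad P (scale w v⁻¹ x))
      (-(2 * v⁻¹ * inner ℝ (actL P (scale w v⁻¹ x)) (actL (diagonal w) (scale w v⁻¹ x)))) v := by
    intro v hv
    have h1 : HasDerivAt (fun v => scale w v⁻¹ x)
        (-(v⁻¹ • (actL (diagonal w)) (scale w v⁻¹ x))) v :=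
      (hasDerivAt_scale_inv w hv).clm_apply (hasDerivAt_const v x) |>.congr_deriv (by simp)
    have h2 := h1.inner ℝ ((actL P).hasFDerivAt.comp_hasDerivAt v h1)
    refine h2.congr_deriv ?_
    simp only [map_neg, map_smul, inner_neg_right, inner_neg_left, inner_smul_left,
      inner_smul_right, conj_trivial, Function.comp_apply, inner_actL_comm h.posDef (scale w v⁻¹ x)]
    rw [real_inner_comm]
    ring
  refine strictAntiOn_of_deriv_neg (convex_Ioi 0)
    (fun v hv => (hd v hv).continuousAt.continuousWithinAt) fun v hv => ?_
  rw [interior_Ioi] at hv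
  rw [(hd v hv).deriv]
  have := h.mono _ (scale_ne_zero w (inv_pos.2 hv) hx)
  have : 0 < v⁻¹ := inv_pos.2 hv
  rw [neg_lt_zero]
  positivity

/-- Intermediate value theorem: contracting `x` enough pushes the form below `1`, and expanding it
enough pushes it above `1`. -/
theorem exists_quad_eq_one (h : IsMonotoneDilation P w) {x : EuclideanSpace ℝ n} (hx : x ≠ 0) :
    ∃ v > 0, quad P (scale w v⁻¹ x) = 1 := by
  obtain ⟨b, hb, hbw⟩ := h.weight_pos
  obtain ⟨c, hc, hcq⟩ := le_quad h.posDef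
  obtain ⟨C, hC, hCq⟩ := quad_le P
  have hx' : 0 < ‖x‖ := norm_pos_iff.2 hx
  have small : ∀ ε > 0, ∃ v : ℝ, 0 < v ∧ v ≤ 1 ∧ v ^ b ≤ ε := by
    intro ε hε
    refine ⟨min 1 (ε ^ b⁻¹), lt_min one_pos (by positivity), min_le_left _ _, ?_⟩
    calc (min 1 (ε ^ b⁻¹)) ^ b ≤ (ε ^ b⁻¹) ^ b :=
          Real.rpow_le_rpow (le_min zero_le_one (by positivity)) (min_le_right _ _) hb.le
      _ = ε := Real.rpow_inv_rpow hε.le hb.ne'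
  obtain ⟨v, hv, hv1, hve⟩ := small (c * ‖x‖) (by positivity)
  -- The scale at which `x` is contracted is `r⁻¹`, so that both ends are controlled by estimates
  -- for parameters at most `1`.
  obtain ⟨r, hr, hr1, hre⟩ := small (1 / (C * ‖x‖)) (by positivity)
  have hle : quad P (scale w (r⁻¹)⁻¹ x) ≤ 1 := by
    rw [inv_inv]
    refine (hCq _).trans (pow_le_one₀ (by positivity) ?_)
    calc C * ‖scale w r x‖ ≤ C * (r ^ b * ‖x‖) := by
          gcongr; exact norm_scale_le_of_le_one hbw hr hr1 x
      _ ≤ C * (1 / (C * ‖x‖) * ‖x‖) := by gcongr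
      _ = 1 := by field_simp
  have hge : 1 ≤ quad P (scale w v⁻¹ x) := by
    refine le_trans (one_le_pow₀ ?_) (hcq _)
    have h1 := norm_scale_le_of_le_one hbw hv hv1 (scale w v⁻¹ x)
    rw [scale_scale_inv w hv] at h1
    have h2 : ‖x‖ * 1 ≤ ‖x‖ * (c * ‖scale w v⁻¹ x‖) := by
      calc ‖x‖ * 1 ≤ v ^ b * ‖scale w v⁻¹ x‖ := by simpa using h1
        _ ≤ (c * ‖x‖) * ‖scale w v⁻¹ x‖ := by gcongr
        _ = _ := by ring
    exact le_of_mul_le_mul_left h2 hx'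
  have hcont : ContinuousOn (fun v => quad P (scale w v⁻¹ x)) (Ioi 0) :=
    (continuous_quad P).comp_continuousOn ((continuousOn_scale_inv w).clm_apply continuousOn_const)
  exact isPreconnected_Ioi.intermediate_value (inv_pos.2 hr) hv hcont ⟨hle, hge⟩

theorem homNorm_spec (h : IsMonotoneDilation P w) {x : EuclideanSpace ℝ n} (hx : x ≠ 0) :
    0 < homNorm P (diagonal w) x ∧ quad P (scale w (homNorm P (diagonal w) x)⁻¹ x) = 1 := by
  have hex : x ≠ 0 ∧ ∃ s : ℝ, weightedNorm P (act (dilation (diagonal w) (-s)) x) = 1 := by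
    obtain ⟨v, hv, hq⟩ := h.exists_quad_eq_one hx
    refine ⟨hx, Real.log v, ?_⟩
    rwa [weightedNorm_eq_one_iff, act_dilation_diagonal, Real.exp_neg, Real.exp_log hv]
  have hs := hex.2.choose_spec
  rw [weightedNorm_eq_one_iff, act_dilation_diagonal, Real.exp_neg] at hs
  have : homNorm P (diagonal w) x = Real.exp hex.2.choose := by
    rw [homNorm, dif_pos hex]
  rw [this]
  exact ⟨Real.exp_pos _, hs⟩

theorem homNorm_eq (h : IsMonotoneDilation P w) {x : EuclideanSpace ℝ n} (hx : x ≠ 0)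
    {v : ℝ} (hv : 0 < v) (hq : quad P (scale w v⁻¹ x) = 1) : homNorm P (diagonal w) x = v :=
  (h.strictAntiOn hx).injOn (h.homNorm_spec hx).1 hv ((h.homNorm_spec hx).2.trans hq.symm)

theorem homNorm_nonneg (h : IsMonotoneDilation P w) (x : EuclideanSpace ℝ n) :
    0 ≤ homNorm P (diagonal w) x := by
  rcases eq_or_ne x 0 with rfl | hx
  · rw [homNorm_zero]
  · exact (h.homNorm_spec hx).1.le

/-- Monotonicity turns a bound on the implicitly defined norm into an inequality for a quadratic
form at a fixed scale. Together with `lt_homNorm_iff` this yields continuity without an implicit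
function theorem. -/
theorem homNorm_lt_iff (h : IsMonotoneDilation P w) (x : EuclideanSpace ℝ n) {v : ℝ} (hv : 0 < v) :
    homNorm P (diagonal w) x < v ↔ quad P (scale w v⁻¹ x) < 1 := by
  rcases eq_or_ne x 0 with rfl | hx
  · simp [homNorm_zero, quad_zero, hv]
  · rw [← (h.homNorm_spec hx).2]
    exact ((h.strictAntiOn hx).lt_iff_gt hv (h.homNorm_spec hx).1).symm

theorem lt_homNorm_iff (h : IsMonotoneDilation P w) (x : EuclideanSpace ℝ n) {v : ℝ} (hv : 0 < v) :
    v < homNorm P (diagonal w) x ↔ 1 < quad P (scale w v⁻¹ x) := by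
  rcases eq_or_ne x 0 with rfl | hx
  · simp [homNorm_zero, quad_zero, not_lt.2 hv.le, (zero_lt_one' ℝ).not_gt]
  · rw [← (h.homNorm_spec hx).2]
    exact ((h.strictAntiOn hx).lt_iff_gt (h.homNorm_spec hx).1 hv).symm

theorem continuous_homNorm (h : IsMonotoneDilation P w) : Continuous (homNorm P (diagonal w)) := by
  have hc : ∀ v : ℝ, Continuous fun x => quad P (scale w v⁻¹ x) := fun v =>
    (continuous_quad P).comp (scale w v⁻¹).continuous
  rw [continuous_iff_continuousAt]
  intro x
  refine tendsto_order.2 ⟨fun v hv => ?_, fun v hv => ?_⟩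
  · rcases lt_trichotomy v 0 with hv0 | rfl | hv0
    · exact Eventually.of_forall fun y => hv0.trans_le (h.homNorm_nonneg y)
    · have hx : x ≠ 0 := by
        rintro rfl
        exact hv.ne' (homNorm_zero _ _)
      filter_upwards [isOpen_ne.mem_nhds hx] with y hy using (h.homNorm_spec hy).1
    · rw [h.lt_homNorm_iff x hv0] at hv
      filter_upwards [(hc v).continuousAt.eventually (lt_mem_nhds hv)] with y hy
      exact (h.lt_homNorm_iff y hv0).2 hy
  · have hv0 : 0 < v := (h.homNorm_nonneg x).trans_lt hv
    rw [gt_iff_lt, h.homNorm_lt_iff x hv0] at hv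
    filter_upwards [(hc v).continuousAt.eventually (gt_mem_nhds hv)] with y hy
    exact (h.homNorm_lt_iff y hv0).2 hy

theorem homNorm_scale (h : IsMonotoneDilation P w) {v : ℝ} (hv : 0 < v) (x : EuclideanSpace ℝ n) :
    homNorm P (diagonal w) (scale w v x) = v * homNorm P (diagonal w) x := by
  rcases eq_or_ne x 0 with rfl | hx
  · simp [homNorm_zero]
  · have hN := h.homNorm_spec hx
    refine h.homNorm_eq (scale_ne_zero w hv hx) (mul_pos hv hN.1) ?_
    rw [_root_.mul_inv_rev, ← scale_scale w (inv_pos.2 hN.1) (inv_pos.2 hv),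
      scale_inv_scale w hv, hN.2]

end IsMonotoneDilation

/-! ### Homogeneity and continuity of the feedback -/

section Feedback

variable {X : Matrix n n ℝ} {w : n → ℝ}

theorem homFeedback_of_ne_zero (h : IsMonotoneDilation X⁻¹ w) (μ : ℝ)
    (Y : Matrix m n ℝ) {x : EuclideanSpace ℝ n} (hx : x ≠ 0) :
    homFeedback μ (diagonal w) X Y x = homNorm X⁻¹ (diagonal w) x ^ (1 + μ) •
      actL (Y * X⁻¹) (scale w (homNorm X⁻¹ (diagonal w) x)⁻¹ x) := by
  rw [homFeedback, act_dilation_diagonal, Real.exp_neg, Real.exp_log (h.homNorm_spec hx).1,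
    actL_apply]

theorem homFeedback_of_quad_eq_one (h : IsMonotoneDilation X⁻¹ w) (μ : ℝ)
    (Y : Matrix m n ℝ) {x : EuclideanSpace ℝ n} (hx : quad X⁻¹ x = 1) :
    homFeedback μ (diagonal w) X Y x = actL (Y * X⁻¹) x := by
  have hx0 : x ≠ 0 := by
    rintro rfl
    simp [quad_zero] at hx
  have : homNorm X⁻¹ (diagonal w) x = 1 := h.homNorm_eq hx0 one_pos (by simpa [scale_one] using hx)
  rw [homFeedback_of_ne_zero h μ Y hx0, this]
  simp [scale_one]

theorem homFeedback_scale (h : IsMonotoneDilation X⁻¹ w) (μ : ℝ)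
    (Y : Matrix m n ℝ) {v : ℝ} (hv : 0 < v) (x : EuclideanSpace ℝ n) :
    homFeedback μ (diagonal w) X Y (scale w v x)
      = v ^ (1 + μ) • homFeedback μ (diagonal w) X Y x := by
  rcases eq_or_ne x 0 with rfl | hx
  · rw [map_zero, homFeedback_zero, smul_zero]
  · have hN := (h.homNorm_spec hx).1
    rw [homFeedback_of_ne_zero h μ Y hx, homFeedback_of_ne_zero h μ Y (scale_ne_zero w hv hx),
      h.homNorm_scale hv, _root_.mul_inv_rev, ← scale_scale w (inv_pos.2 hN) (inv_pos.2 hv),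
      scale_inv_scale w hv, Real.mul_rpow hv.le hN.le, smul_smul]

/-- Only the origin is delicate: the normalised argument stays on the compact `P`-unit sphere, and
the factor `‖x‖_d ^ (1 + μ)` tends to `0` exactly because `1 + μ > 0`. -/
theorem continuous_homFeedback (h : IsMonotoneDilation X⁻¹ w) (Y : Matrix m n ℝ) {μ : ℝ}
    (hμ : -1 < μ) : Continuous (homFeedback μ (diagonal w) X Y) := by
  rw [continuous_iff_continuousAt]
  intro x
  have hN := h.continuous_homNorm.continuousAt (x := x)
  rcases eq_or_ne x 0 with rfl | hx
  · obtain ⟨c, hc, hcq⟩ := le_quad h.posDef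
    rw [ContinuousAt, homFeedback_zero]
    have hlim : Tendsto (fun x => homNorm X⁻¹ (diagonal w) x ^ (1 + μ) *
        (‖actL (Y * X⁻¹)‖ * (1 / c))) (𝓝 0) (𝓝 0) := by
      have := (hN.rpow_const (Or.inr (by linarith : 0 ≤ 1 + μ))).tendsto.mul_const
        (‖actL (Y * X⁻¹)‖ * (1 / c))
      rwa [homNorm_zero, Real.zero_rpow (by linarith), zero_mul] at this
    refine squeeze_zero_norm (fun y => ?_) hlim
    rcases eq_or_ne y 0 with rfl | hy
    · rw [homFeedback_zero, norm_zero, homNorm_zero, Real.zero_rpow (by linarith), zero_mul]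
    · have hNy := h.homNorm_spec hy
      rw [homFeedback_of_ne_zero h μ Y hy, norm_smul, Real.norm_eq_abs,
        abs_of_nonneg (Real.rpow_nonneg hNy.1.le _)]
      refine mul_le_mul_of_nonneg_left ?_ (Real.rpow_nonneg hNy.1.le _)
      refine ((actL (Y * X⁻¹)).le_opNorm _).trans ?_
      gcongr
      have h1 := hcq (scale w (homNorm X⁻¹ (diagonal w) y)⁻¹ y)
      rw [hNy.2] at h1
      rw [le_div_iff₀ hc, mul_comm]
      exact (abs_le_one_iff_mul_self_le_one.2 (by rwa [← sq])).trans' (le_abs_self _)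
  · have hNx := (h.homNorm_spec hx).1
    have hev : (fun y => homNorm X⁻¹ (diagonal w) y ^ (1 + μ) •
        actL (Y * X⁻¹) (scale w (homNorm X⁻¹ (diagonal w) y)⁻¹ y)) =ᶠ[𝓝 x]
        homFeedback μ (diagonal w) X Y := by
      filter_upwards [isOpen_ne.mem_nhds hx] with y hy
      exact (homFeedback_of_ne_zero h μ Y hy).symm
    refine ContinuousAt.congr ?_ hev
    have h1 : ContinuousAt (fun y => scale w (homNorm X⁻¹ (diagonal w) y)⁻¹) x :=
      ContinuousAt.comp (f := homNorm X⁻¹ (diagonal w)) (g := fun v => scale w v⁻¹)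
        (hasDerivAt_scale_inv w hNx).continuousAt hN
    exact (hN.rpow_const (Or.inl hNx.ne')).smul
      ((actL (Y * X⁻¹)).continuous.continuousAt.comp (h1.clm_apply continuousAt_id))

end Feedback

end HomogeneousNorm

/-! ### Consequences of the design equations and robustness of the decay -/

section Design

variable {μ ρ : ℝ} {G₀ : Matrix Ix Ix ℝ} {Y₀ : Matrix (Fin 3) Ix ℝ} {X : Matrix Ix Ix ℝ}
  {Y : Matrix (Fin 3) Ix ℝ}

/-- The weights of the dilation: `1 - μ` for the angles and `1` for the velocities. -/
def weight (μ : ℝ) : Ix → ℝ := Sum.elim (fun _ => 1 - μ) (fun _ => 1)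

/-- `G₀ B = 0` kills the right block column of `G₀`; the four blocks of the commutator equation then
determine the rest. -/
theorem IsHomogeneousDesign.generator_eq_fromBlocks
    (h : IsHomogeneousDesign matA matB μ ρ G₀ Y₀ X Y) :
    G₀ = fromBlocks (-1) 0 0 0 ∧ Y₀ = 0 := by
  have h1 := h.generator_eq
  have h2 := h.generator_input
  rw [← fromBlocks_toBlocks G₀, ← fromCols_toCols Y₀] at h1
  rw [← fromBlocks_toBlocks G₀] at h2 ⊢
  rw [← fromCols_toCols Y₀]
  simp only [matA, matB, fromBlocks_mul_fromRows, fromBlocks_multiply, fromRows_mul_fromCols,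
    Matrix.mul_zero, Matrix.zero_mul, Matrix.mul_one, Matrix.one_mul, add_zero, zero_add] at h1 h2
  rw [sub_eq_add_neg, fromBlocks_neg, fromBlocks_add, fromBlocks_add, fromBlocks_inj] at h1
  have h3 : G₀.toBlocks₁₂ = 0 := by
    ext i j; simpa using congrFun (congrFun h2 (Sum.inl i)) j
  have h4 : G₀.toBlocks₂₂ = 0 := by
    ext i j; simpa using congrFun (congrFun h2 (Sum.inr i)) j
  obtain ⟨a1, a2, a3, a4⟩ := h1
  simp only [h4, neg_zero, add_zero, zero_add] at a1 a2 a3 a4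
  rw [h3, h4, a1, neg_eq_iff_eq_neg.1 a2, a3]
  rw [a1] at a4
  simp only [neg_zero, zero_add] at a4
  rw [a4]
  exact ⟨rfl, fromCols_zero⟩

theorem IsHomogeneousDesign.generator_eq_diagonal
    (h : IsHomogeneousDesign matA matB μ ρ G₀ Y₀ X Y) : generator μ G₀ = diagonal (weight μ) := by
  rw [generator, h.generator_eq_fromBlocks.1]
  ext i j
  rcases i with i | i <;> rcases j with j | j <;>
    by_cases hij : i = j <;>
    simp [weight, hij, sub_eq_add_neg]

/-- A diagonal entry in the angle block of the monotonicity matrix is `2 (1 - μ)` times a positive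
entry of `X`. -/
theorem IsHomogeneousDesign.degree_lt_one
    (h : IsHomogeneousDesign matA matB μ ρ G₀ Y₀ X Y) : μ < 1 := by
  have h1 := h.monotone.diag_pos (i := Sum.inl 0)
  have h2 := h.posDef.diag_pos (i := Sum.inl 0)
  rw [h.generator_eq_diagonal] at h1
  simp [weight] at h1
  nlinarith

/-- The velocity eigenvalue of `μ I + G` is `1 + μ`; the angle eigenvalue is `1` and carries no
information. -/
theorem IsHomogeneousDesign.neg_one_lt_degree
    (h : IsHomogeneousDesign matA matB μ ρ G₀ Y₀ X Y)
    (hμ : IsAntiHurwitz (μ • (1 : Matrix Ix Ix ℝ) + generator μ G₀)) : -1 < μ := by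
  have h1 : (-(μ • (1 : Matrix Ix Ix ℝ) + generator μ G₀)).map (algebraMap ℝ ℂ)
      = diagonal (fun i => -((μ : ℂ) + (weight μ i : ℂ))) := by
    rw [h.generator_eq_diagonal]
    ext i j
    by_cases hij : i = j
    · subst hij; simp
    · simp [hij]
  have h2 := hμ (-((μ : ℂ) + (weight μ (Sum.inr 0) : ℂ))) (by
    rw [h1, spectrum_diagonal]
    exact ⟨Sum.inr 0, rfl⟩)
  simp [weight] at h2
  linarith

theorem weight_le_two (hμ : -1 < μ) (i : Ix) : weight μ i ≤ 2 := by
  rcases i with i | i <;> simp [weight]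
  linarith

theorem le_weight (hμ : -1 < μ) (hμ1 : μ < 1) (i : Ix) : (1 - μ) / 2 ≤ weight μ i := by
  rcases i with i | i <;> simp [weight] <;> linarith

theorem IsHomogeneousDesign.actL_actL_inv
    (h : IsHomogeneousDesign matA matB μ ρ G₀ Y₀ X Y) (y : State) : actL X (actL X⁻¹ y) = y := by
  rw [← actL_mul, Matrix.mul_nonsing_inv _ ((Matrix.isUnit_iff_isUnit_det _).1 h.posDef.isUnit)]
  ext i; simp [ofLp_actL]

theorem IsHomogeneousDesign.inner_actL_mul_transpose
    (h : IsHomogeneousDesign matA matB μ ρ G₀ Y₀ X Y) (M : Matrix Ix Ix ℝ) (z : State) :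
    inner ℝ z (actL (X * Mᵀ) z) = inner ℝ z (actL (M * X) z) := by
  have hT : Xᵀ = X := by simpa using h.posDef.isHermitian.eq
  rw [← inner_actL_transpose (M * X), transpose_mul, hT]

/-- The Lyapunov identity `yᵀ P (A + B K) y = -ρ yᵀ P G y` with `P = X⁻¹`. -/
theorem IsHomogeneousDesign.inner_closedLoop
    (h : IsHomogeneousDesign matA matB μ ρ G₀ Y₀ X Y) (y : State) :
    inner ℝ (actL X⁻¹ y) (actL matA y + actL matB (actL (Y * X⁻¹) y))
      = -ρ * inner ℝ (actL X⁻¹ y) (actL (diagonal (weight μ)) y) := by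
  have key := h.lyapunov_eq
  rw [h.generator_eq_fromBlocks.2, h.generator_eq_diagonal] at key
  set z := actL X⁻¹ y with hz
  have hXz : actL X z = y := h.actL_actL_inv y
  have key2 := congrArg (fun M => inner ℝ z (actL M z)) key
  have e1 : actL (0 : Matrix Ix Ix ℝ) z = 0 := by ext i; simp [ofLp_actL]
  have e2 : inner ℝ z (actL (Yᵀ * matBᵀ) z) = inner ℝ z (actL (matB * Y) z) := by
    rw [← inner_actL_transpose (matB * Y), transpose_mul]
  simp only [Matrix.mul_zero, Matrix.zero_mul, add_zero, add_actL, smul_actL, e1, e2,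
    inner_add_right, h.inner_actL_mul_transpose, inner_smul_right, inner_zero_right] at key2
  simp only [actL_mul, hXz] at key2
  rw [actL_mul, ← hz, inner_add_right]
  linarith

theorem IsHomogeneousDesign.isMonotoneDilation
    (h : IsHomogeneousDesign matA matB μ ρ G₀ Y₀ X Y) (hμ : -1 < μ) :
    IsMonotoneDilation X⁻¹ (weight μ) where
  posDef := h.posDef.inv
  weight_pos := ⟨(1 - μ) / 2, by linarith [h.degree_lt_one], le_weight hμ h.degree_lt_one⟩
  mono := fun y hy => by
    have hXz := h.actL_actL_inv y
    set z := actL X⁻¹ y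
    have hz0 : z ≠ 0 := by
      intro h0
      rw [h0, map_zero] at hXz
      exact hy hXz.symm
    have h1 := quad_pos h.monotone hz0
    rw [h.generator_eq_diagonal, quad, add_actL, inner_add_right, h.inner_actL_mul_transpose,
      actL_mul, hXz] at h1
    linarith

/-- `A` moves velocities (weight `1`) into angle slots (weight `1 - μ`), and the mismatch is the
factor `v ^ μ`. With `scale_inv_matB` and `homFeedback_scale`, this makes the closed loop
homogeneous of degree `μ`. -/
theorem scale_inv_matA {v : ℝ} (hv : 0 < v) (x : State) :
    scale (weight μ) v⁻¹ (actL matA x) = v ^ μ • actL matA (scale (weight μ) v⁻¹ x) := by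
  ext i
  rcases i with i | i
  · have : v⁻¹ ^ (1 - μ) = v ^ μ * v⁻¹ := by
      rw [Real.rpow_sub (inv_pos.2 hv), Real.rpow_one, Real.inv_rpow hv.le, div_inv_eq_mul,
        mul_comm]
    simp [scale_apply, ofLp_actL, matA, mulVec, dotProduct, Fintype.sum_sum_type, Matrix.one_apply,
      weight, this]
    ring
  · simp [scale_apply, ofLp_actL, matA, mulVec, dotProduct, Fintype.sum_sum_type]

theorem scale_inv_matB (v : ℝ) (x : EuclideanSpace ℝ (Fin 3)) :
    scale (weight μ) v⁻¹ (actL matB x) = v⁻¹ • actL matB x := by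
  ext i
  rcases i with i | i
  · simp [scale_apply, ofLp_actL, matB, mulVec, dotProduct]
  · simp [scale_apply, weight]

/-- `η` is a margin of robustness: along the closed loop with noise `e₁` and perturbation `e₂` of
size at most `η v²`, the rate of change of the weighted norm at the scale `v ≤ 1` is at most half of
the unperturbed one. -/
def IsRobustnessMargin (μ ρ : ℝ) (X : Matrix Ix Ix ℝ) (Y : Matrix (Fin 3) Ix ℝ) (η : ℝ) : Prop :=
  ∀ v : ℝ, 0 < v → v ≤ 1 → ∀ x e₁ e₂ : State,
    quad X⁻¹ (scale (weight μ) v⁻¹ x) = 1 → ‖e₁‖ ≤ η * v ^ 2 → ‖e₂‖ ≤ η * v ^ 2 →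
    inner ℝ (actL X⁻¹ (scale (weight μ) v⁻¹ x)) (scale (weight μ) v⁻¹
      (actL matA x + actL matB (homFeedback μ (diagonal (weight μ)) X Y (x + e₁)) + e₂))
    ≤ -(ρ / 2) * v ^ μ * inner ℝ (actL X⁻¹ (scale (weight μ) v⁻¹ x))
        (actL (diagonal (weight μ)) (scale (weight μ) v⁻¹ x))

theorem IsHomogeneousDesign.exists_robustnessMargin
    (h : IsHomogeneousDesign matA matB μ ρ G₀ Y₀ X Y) (hμ : -1 < μ) :
    ∃ η > 0, IsRobustnessMargin μ ρ X Y η := by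
  have hD := h.isMonotoneDilation hμ
  set P := X⁻¹
  set w := weight μ
  set u := homFeedback μ (diagonal w) X Y
  have hu : Continuous u := continuous_homFeedback hD Y hμ
  have hK := isCompact_quad_eq_one hD.posDef
  set S : Set State := {x : State | quad P x = 1}
  obtain ⟨κ, hκ, hκS⟩ : ∃ κ > 0, ∀ y ∈ S, κ ≤ inner ℝ (actL P y) (actL (diagonal w) y) := by
    refine hK.exists_forall_le' (f := fun y => inner ℝ (actL P y) (actL (diagonal w) y))
      ((actL P).continuous.inner (actL (diagonal w)).continuous).continuousOn (fun y hy => ?_)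
    refine hD.mono y ?_
    rintro rfl
    simp [S, quad_zero] at hy
  obtain ⟨C, hC⟩ : ∃ C, ∀ y ∈ S, ‖actL P y‖ ≤ C :=
    hK.exists_bound_of_continuousOn (actL P).continuous.continuousOn
  have hC1 : ∀ y ∈ S, ‖actL P y‖ ≤ |C| + 1 := fun y hy => by
    linarith [hC y hy, le_abs_self C]
  have hρ := h.rate_pos
  -- Each of the two error terms may cost `ρ κ / 4`; together they use at most half of the decay `ρ
  -- κ` available on the sphere.
  set ε := ρ * κ / (4 * (|C| + 1)) with hε
  have hε0 : 0 < ε := by positivity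
  -- Compactness makes continuity uniform at points of the sphere, while `y + e` may lie off it.
  obtain ⟨η₁, hη₁, hη₁u⟩ : ∃ η > 0, ∀ y ∈ S, ∀ e, ‖e‖ < η → ‖actL matB (u (y + e) - u y)‖ ≤ ε := by
    have hc : Continuous fun y => actL matB (u y) := (actL matB).continuous.comp hu
    have h1 := hK.uniformContinuousAt_of_continuousAt _ (fun a _ => hc.continuousAt)
      (Metric.dist_mem_uniformity hε0)
    obtain ⟨η, hη, hηu⟩ := Metric.mem_uniformity_dist.1 h1
    refine ⟨η, hη, fun y hy e he => ?_⟩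
    have := hηu (a := y) (b := y + e) (by simpa [dist_eq_norm] using he) hy
    rw [mem_ofPred_eq, dist_comm, dist_eq_norm, ← map_sub] at this
    exact this.le
  refine ⟨min (η₁ / 2) ε, lt_min (by positivity) hε0, fun v hv hv1 x e₁ e₂ hq he₁ he₂ => ?_⟩
  set y := scale w v⁻¹ x with hy
  have hp : v⁻¹ ^ (2 : ℝ) * v ^ 2 = 1 := by
    rw [Real.rpow_two]; field_simp
  have hse : ∀ e : State, ‖e‖ ≤ min (η₁ / 2) ε * v ^ 2 → ‖scale w v⁻¹ e‖ ≤ min (η₁ / 2) ε := by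
    intro e he
    calc ‖scale w v⁻¹ e‖ ≤ v⁻¹ ^ (2 : ℝ) * ‖e‖ :=
          norm_scale_inv_le_of_le_one (weight_le_two hμ) hv hv1 e
      _ ≤ v⁻¹ ^ (2 : ℝ) * (min (η₁ / 2) ε * v ^ 2) := by gcongr
      _ = min (η₁ / 2) ε := by rw [mul_left_comm, hp, mul_one]
  -- Dividing by `v ^ μ` raises the exponents to `μ + wᵢ`, that is `1` or `1 + μ`, still at most
  -- `2`; hence the single threshold `η v²` serves both errors.
  have hse₂ : ‖v⁻¹ ^ μ • scale w v⁻¹ e₂‖ ≤ ε := by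
    have : ‖v⁻¹ ^ μ • scale w v⁻¹ e₂‖ ≤ v⁻¹ ^ (2 : ℝ) * ‖e₂‖ := by
      refine norm_le_mul_norm_of_coord_le (by positivity) fun i => ?_
      rw [PiLp.smul_apply, smul_eq_mul, scale_apply, ← mul_assoc, ← Real.rpow_add (inv_pos.2 hv),
        abs_mul, abs_of_pos (by positivity)]
      refine mul_le_mul_of_nonneg_right (Real.rpow_le_rpow_of_exponent_le
        ((one_le_inv₀ hv).2 hv1) ?_) (abs_nonneg _)
      have := h.degree_lt_one
      rcases i with i | i <;> simp [w, weight]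
      linarith
    calc _ ≤ v⁻¹ ^ (2 : ℝ) * ‖e₂‖ := this
      _ ≤ v⁻¹ ^ (2 : ℝ) * (ε * v ^ 2) := by
        gcongr
        exact he₂.trans (by gcongr; exact min_le_right _ _)
      _ = ε := by rw [mul_left_comm, hp, mul_one]
  have hux : u (x + e₁) = v ^ (1 + μ) • u (y + scale w v⁻¹ e₁) := by
    rw [hy, ← map_add, ← homFeedback_scale hD μ Y hv, scale_scale_inv w hv]
  have hv' : v⁻¹ * v ^ (1 + μ) = v ^ μ := by
    rw [Real.rpow_add hv, Real.rpow_one]; field_simp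
  have hvv : v ^ μ * v⁻¹ ^ μ = 1 := by
    rw [Real.inv_rpow hv.le]; field_simp
  have hdec : scale w v⁻¹ (actL matA x + actL matB (u (x + e₁)) + e₂)
      = v ^ μ • ((actL matA y + actL matB (actL (Y * P) y))
        + actL matB (u (y + scale w v⁻¹ e₁) - u y) + v⁻¹ ^ μ • scale w v⁻¹ e₂) := by
    rw [← homFeedback_of_quad_eq_one hD μ Y hq, map_add, map_add, scale_inv_matA hv,
      scale_inv_matB, hux, map_smul, smul_smul, hv', map_sub, smul_add, smul_add,
      smul_smul _ _ (scale w v⁻¹ e₂), hvv, one_smul, smul_add, smul_sub]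
    abel
  rw [hdec, inner_smul_right, inner_add_right, inner_add_right, h.inner_closedLoop]
  have hyS : y ∈ S := hq
  have b1 : inner ℝ (actL P y) (actL matB (u (y + scale w v⁻¹ e₁) - u y)) ≤ (|C| + 1) * ε :=
    (real_inner_le_norm _ _).trans (mul_le_mul (hC1 y hyS) (hη₁u y hyS _
      ((hse e₁ he₁).trans_lt ((min_le_left _ _).trans_lt (by linarith)))) (norm_nonneg _)
      (by positivity))
  have b2 : inner ℝ (actL P y) (v⁻¹ ^ μ • scale w v⁻¹ e₂) ≤ (|C| + 1) * ε :=
    (real_inner_le_norm _ _).trans (mul_le_mul (hC1 y hyS) hse₂ (norm_nonneg _) (by positivity))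
  have b3 : (|C| + 1) * ε = ρ * κ / 4 := by rw [hε]; field_simp
  rw [mul_comm (-(ρ / 2)), mul_assoc]
  refine mul_le_mul_of_nonneg_left ?_ (by positivity)
  nlinarith [hκS y hyS]

end Design

/-! ### Barrier argument with a shrinking homogeneous ball -/

section Comparison

/-- If a Lipschitz curve `x` moves so that the first-order change of `xᵀ Dᵀ P D x` is negative, then
this quantity does not grow. -/
theorem eventually_quad_le {n : Type} [Fintype n] {P : Matrix n n ℝ} (hP : P.PosDef)
    {D : ℝ → EuclideanSpace ℝ n →L[ℝ] EuclideanSpace ℝ n}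
    {D' : EuclideanSpace ℝ n →L[ℝ] EuclideanSpace ℝ n} {t L κ : ℝ} (hD : HasDerivAt D D' t)
    {x : ℝ → EuclideanSpace ℝ n} (hL : ∀ᶠ z in 𝓝[>] t, ‖x z - x t‖ ≤ L * (z - t))
    (hκ : ∀ᶠ z in 𝓝[>] t, inner ℝ (actL P (D t (x t))) (D t (x z - x t)) ≤ κ * (z - t))
    (hneg : inner ℝ (actL P (D t (x t))) (D' (x t)) + κ < 0) :
    ∀ᶠ z in 𝓝[>] t, quad P (D z (x z)) ≤ quad P (D t (x t)) := by
  obtain ⟨C, hC, hCq⟩ := quad_le P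
  set p := actL P (D t (x t))
  have hzt : Tendsto (fun z : ℝ => z - t) (𝓝[>] t) (𝓝 0) := by
    have : Tendsto (fun z : ℝ => z - t) (𝓝 t) (𝓝 (t - t)) := tendsto_id.sub tendsto_const_nhds
    rw [sub_self] at this
    exact this.mono_left nhdsWithin_le_nhds
  have hx : Tendsto x (𝓝[>] t) (𝓝 (x t)) := by
    rw [tendsto_iff_norm_sub_tendsto_zero]
    refine squeeze_zero' (Eventually.of_forall fun _ => norm_nonneg _) hL ?_
    simpa using hzt.const_mul L
  have hslope' : Tendsto (slope D t) (𝓝[>] t) (𝓝 D') :=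
    (hasDerivAt_iff_tendsto_slope.1 hD).mono_left
      (nhdsWithin_mono t fun z (hz : t < z) => hz.ne')
  have happ : Continuous fun p : (EuclideanSpace ℝ n →L[ℝ] EuclideanSpace ℝ n) ×
      EuclideanSpace ℝ n => p.1 p.2 := by fun_prop
  have hslope : Tendsto (fun z => slope D t z (x z)) (𝓝[>] t) (𝓝 (D' (x t))) :=
    (happ.tendsto (D', x t)).comp (hslope'.prodMk_nhds hx)
  set K := ‖D' (x t)‖ + 1 + ‖D t‖ * |L|
  -- The increment of the form over `z - t` is bounded by this expression: first-order terms from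
  -- the moving `D` and the moving `x`, plus a quadratic remainder.
  have hb : Tendsto (fun z => 2 * (inner ℝ p (slope D t z (x z)) + κ) + (C * K) ^ 2 * (z - t))
      (𝓝[>] t) (𝓝 (2 * (inner ℝ p (D' (x t)) + κ) + (C * K) ^ 2 * 0)) :=
    (((tendsto_const_nhds.inner hslope).add_const κ).const_mul 2).add (hzt.const_mul _)
  filter_upwards [hL, hκ, hb.eventually (gt_mem_nhds (show _ < (0 : ℝ) by linarith)),
    hslope.norm.eventually (gt_mem_nhds (lt_add_one ‖D' (x t)‖)), self_mem_nhdsWithin]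
    with z h1 h2 h3 h4 hz
  have hz' : 0 < z - t := sub_pos.2 hz
  have hdec : D z (x z) = D t (x t) + ((z - t) • slope D t z (x z) + D t (x z - x t)) := by
    have : (z - t) • slope D t z (x z) = D z (x z) - D t (x z) := by
      rw [← _root_.smul_apply, sub_smul_slope]; rfl
    rw [this, map_sub]
    abel
  have hnorm : ‖(z - t) • slope D t z (x z) + D t (x z - x t)‖ ≤ K * (z - t) := by
    calc _ ≤ ‖(z - t) • slope D t z (x z)‖ + ‖D t (x z - x t)‖ := norm_add_le _ _
      _ ≤ (z - t) * (‖D' (x t)‖ + 1) + ‖D t‖ * (|L| * (z - t)) := by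
        rw [norm_smul, Real.norm_eq_abs, abs_of_pos hz']
        gcongr
        refine ((D t).le_opNorm _).trans ?_
        gcongr
        exact h1.trans (by gcongr; exact le_abs_self L)
      _ = _ := by ring
  rw [hdec, quad_add hP, inner_add_right, inner_smul_right]
  have hq : quad P ((z - t) • slope D t z (x z) + D t (x z - x t)) ≤ (C * K) ^ 2 * (z - t) ^ 2 := by
    refine (hCq _).trans ?_
    rw [← mul_pow, mul_assoc]
    gcongr
  have h5 := mul_neg_of_pos_of_neg hz' h3
  linarith

/-- `x` solves `ẋ = f (t, x)` on `[0, T]` in integral form, without jumps. -/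
def IsFlowOn {E : Type} [NormedAddCommGroup E] [NormedSpace ℝ E] (f : ℝ → E → E) (T : ℝ)
    (x : ℝ → E) : Prop :=
  ∀ a b : ℝ, 0 ≤ a → a ≤ b → b ≤ T →
    IntervalIntegrable (fun s => f s (x s)) volume a b ∧ x b = x a + ∫ s in a..b, f s (x s)

theorem IsFlowOn.continuousOn {E : Type} [NormedAddCommGroup E] [NormedSpace ℝ E]
    {f : ℝ → E → E} {T : ℝ} {x : ℝ → E} (hx : IsFlowOn f T x) : ContinuousOn x (Icc 0 T) := by
  rcases lt_or_ge T 0 with hT | hT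
  · simp [Icc_eq_empty hT.not_ge]
  have h1 := intervalIntegral.continuousOn_primitive_interval' (hx 0 T le_rfl hT le_rfl).1
    left_mem_uIcc
  rw [uIcc_of_le hT] at h1
  have h2 : ContinuousOn (fun t => x 0 + ∫ s in (0 : ℝ)..t, f s (x s)) (Icc 0 T) :=
    continuousOn_const.add h1
  exact h2.congr fun t ht => (hx 0 t le_rfl ht.1 ht.2).2

/-- The comparison function `v₀ / (1 + c v₀ t) + χ`. -/
def envelope (c v₀ χ t : ℝ) : ℝ := v₀ / (1 + c * v₀ * t) + χ

variable {μ ρ : ℝ} {G₀ : Matrix Ix Ix ℝ} {Y₀ : Matrix (Fin 3) Ix ℝ} {X : Matrix Ix Ix ℝ}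
  {Y : Matrix (Fin 3) Ix ℝ}

theorem hasDerivAt_envelope {c v₀ χ t : ℝ} (hc : 0 < c) (hv : 0 < v₀) (ht : 0 ≤ t) :
    HasDerivAt (envelope c v₀ χ) (-(c * (v₀ / (1 + c * v₀ * t)) ^ 2)) t := by
  have hpos : 0 < 1 + c * v₀ * t := by positivity
  have h1 : HasDerivAt (fun t => 1 + c * v₀ * t) (c * v₀) t := by
    simpa using ((hasDerivAt_id t).const_mul (c * v₀)).const_add 1
  have h2 := ((hasDerivAt_const t v₀).div h1 hpos.ne').add_const χ
  refine h2.congr_deriv ?_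
  field_simp
  ring

/-- On the boundary of the tube the homogeneous norm decreases at rate at least `(ρ/2) β ^ (1 + μ)`,
while the radius shrinks at rate at most `(ρ/4) β²`. The field need only be the closed loop on a
ball containing the tube, so truncated fields are covered. -/
theorem IsHomogeneousDesign.quad_scale_envelope_le_one
    (h : IsHomogeneousDesign matA matB μ ρ G₀ Y₀ X Y) (hμ : -1 < μ) {η : ℝ} (hη : 0 < η)
    (hrob : IsRobustnessMargin μ ρ X Y η) {F : State → Disturbance → State}
    (hF : Continuous (Function.uncurry F)) {R : ℝ}
    (hFR : ∀ x w, ‖x‖ < R →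
      F x w = perturbedField (homFeedback μ (diagonal (weight μ)) X Y) x w)
    {δ : ℝ → Disturbance} {x : ℝ → State} {T d v₀ χ : ℝ}
    (hδ : ∀ᵐ s ∂(volume.restrict (Ioo 0 T)), ‖δ s‖ ≤ d)
    (hx : IsFlowOn (fun t y => F y (δ t)) T x) (hv₀ : 0 < v₀) (hχ : 0 ≤ χ) (hvχ : v₀ + χ ≤ 1)
    (hd : d ≤ η * χ ^ 2) (hx₀ : quad X⁻¹ (scale (weight μ) (v₀ + χ)⁻¹ (x 0)) ≤ 1)
    (hR : ∀ (v : ℝ) (y : State), 0 < v → v ≤ v₀ + χ →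
      quad X⁻¹ (scale (weight μ) v⁻¹ y) ≤ 1 → ‖y‖ < R) {t : ℝ} (ht : t ∈ Icc 0 T) :
    quad X⁻¹ (scale (weight μ) (envelope (ρ / 4) v₀ χ t)⁻¹ (x t)) ≤ 1 := by
  have hρ := h.rate_pos
  have hD := h.isMonotoneDilation hμ
  set w := weight μ
  set P := X⁻¹
  set u := homFeedback μ (diagonal w) X Y
  set β := envelope (ρ / 4) v₀ χ
  have hfrac : ∀ t : ℝ, 0 ≤ t → 0 < v₀ / (1 + ρ / 4 * v₀ * t) := fun t ht => by positivity
  have hfrac1 : ∀ t : ℝ, 0 ≤ t → v₀ / (1 + ρ / 4 * v₀ * t) ≤ v₀ := fun t ht =>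
    div_le_self hv₀.le (by have : 0 ≤ ρ / 4 * v₀ * t := by positivity
                           linarith)
  have hβpos : ∀ t : ℝ, 0 ≤ t → 0 < β t := fun t ht => add_pos_of_pos_of_nonneg (hfrac t ht) hχ
  have hβle : ∀ t : ℝ, 0 ≤ t → β t ≤ v₀ + χ := fun t ht => by
    have := hfrac1 t ht
    simp only [β, envelope]
    linarith
  have hβd : ∀ t : ℝ, 0 ≤ t → HasDerivAt β (-(ρ / 4 * (v₀ / (1 + ρ / 4 * v₀ * t)) ^ 2)) t :=
    fun t ht => hasDerivAt_envelope (by positivity) hv₀ ht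
  have hDd : ∀ t : ℝ, 0 ≤ t → HasDerivAt (fun t => scale w (β t)⁻¹)
      ((-(ρ / 4 * (v₀ / (1 + ρ / 4 * v₀ * t)) ^ 2)) •
        -((β t)⁻¹ • (actL (diagonal w)).comp (scale w (β t)⁻¹))) t := fun t ht =>
    (hasDerivAt_scale_inv w (hβpos t ht)).scomp t (hβd t ht)
  have hxc := hx.continuousOn
  have hgc : ContinuousOn (fun t => quad P (scale w (β t)⁻¹ (x t))) (Icc 0 T) :=
    (continuous_quad P).comp_continuousOn
      (ContinuousOn.clm_apply (fun t ht => (hDd t ht.1).continuousAt.continuousWithinAt) hxc)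
  suffices hsub : Icc 0 T ⊆ {t | quad P (scale w (β t)⁻¹ (x t)) ≤ 1} from hsub ht
  -- Continuous induction on time: the good set is closed, and can be prolonged to the right of each
  -- of its points.
  refine IsClosed.Icc_subset_of_forall_exists_gt ?_ ?_ ?_
  · rw [inter_comm]
    exact hgc.preimage_isClosed_of_isClosed isClosed_Icc isClosed_Iic
  · have : β 0 = v₀ + χ := by simp [β, envelope]
    rw [mem_ofPred_eq, this]
    exact hx₀
  rintro t ⟨htg, ht⟩ y hy
  suffices hev : ∀ᶠ z in 𝓝[>] t, quad P (scale w (β z)⁻¹ (x z)) ≤ 1 by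
    obtain ⟨z, hz1, hz2⟩ := (hev.and (Ioc_mem_nhdsGT hy)).exists
    exact ⟨z, hz1, hz2⟩
  have hnh : 𝓝[>] t ≤ 𝓝[Icc 0 T] t := by
    rw [← nhdsWithin_Ioo_eq_nhdsGT ht.2]
    exact nhdsWithin_mono t fun z hz => ⟨ht.1.trans hz.1.le, hz.2.le⟩
  rcases lt_or_eq_of_le (show quad P (scale w (β t)⁻¹ (x t)) ≤ 1 from htg) with hlt | heq
  · filter_upwards [((hgc t ⟨ht.1, ht.2.le⟩).mono_left hnh).eventually (gt_mem_nhds hlt)]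
      with z hz using hz.le
  have hβ := hβpos t ht.1
  have hβ1 : β t ≤ 1 := (hβle t ht.1).trans hvχ
  have hxR : ‖x t‖ < R := hR (β t) (x t) hβ (hβle t ht.1) heq.le
  -- The inequality is strict since `β t > χ`; the slack absorbs the motion of the state over a
  -- short time.
  have hdβ : d < η * β t ^ 2 := by
    refine hd.trans_lt (mul_lt_mul_of_pos_left (pow_lt_pow_left₀ ?_ hχ two_ne_zero) hη)
    simp only [β, envelope]
    linarith [hfrac t ht.1]
  have hxt : Tendsto x (𝓝[>] t) (𝓝 (x t)) := (hxc t ⟨ht.1, ht.2.le⟩).mono_left hnh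
  have hxt0 : Tendsto (fun s => ‖x s - x t‖) (𝓝[>] t) (𝓝 0) :=
    tendsto_iff_norm_sub_tendsto_zero.1 hxt
  have hnear : ∀ᶠ s in 𝓝[>] t, ‖x s‖ < R ∧ ‖x s - x t‖ < 1 ∧
      d + (1 + ‖actL matA‖) * ‖x s - x t‖ < η * β t ^ 2 ∧ s < T := by
    have h3 : Tendsto (fun s => d + (1 + ‖actL matA‖) * ‖x s - x t‖) (𝓝[>] t) (𝓝 d) := by
      simpa using (hxt0.const_mul (1 + ‖actL matA‖)).const_add d
    filter_upwards [hxt.norm.eventually (gt_mem_nhds hxR), hxt0.eventually (gt_mem_nhds one_pos),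
      h3.eventually (gt_mem_nhds hdβ), Ioo_mem_nhdsGT ht.2] with s h1 h2 h3 h4
    exact ⟨h1, h2, h3, h4.2⟩
  obtain ⟨t₁, ht₁, hsub⟩ := mem_nhdsGT_iff_exists_Ioo_subset.1 hnear
  have : ProperSpace Disturbance := FiniteDimensional.proper ℝ Disturbance
  obtain ⟨M, hM⟩ := ((isCompact_closedBall (x t) 1).prod
    (isCompact_closedBall (0 : Disturbance) d)).exists_bound_of_continuousOn hF.continuousOn
  set J := inner ℝ (actL P (scale w (β t)⁻¹ (x t))) (actL (diagonal w) (scale w (β t)⁻¹ (x t)))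
    with hJ
  have hJ0 : 0 < J := by
    refine hD.mono _ fun h0 => ?_
    rw [h0, quad_zero] at heq
    exact zero_ne_one heq
  have hδ' : ∀ᵐ s, s ∈ Ioo 0 T → ‖δ s‖ ≤ d := (ae_restrict_iff' measurableSet_Ioo).1 hδ
  have hmain : ∀ᵐ s, s ∈ Ioo t t₁ → ‖F (x s) (δ s)‖ ≤ M ∧
      inner ℝ (actL P (scale w (β t)⁻¹ (x t))) (scale w (β t)⁻¹ (F (x s) (δ s)))
        ≤ -(ρ / 2) * β t ^ μ * J := by
    filter_upwards [hδ'] with s hs hst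
    obtain ⟨n1, n2, n3, n4⟩ := hsub hst
    have hsd := hs ⟨ht.1.trans_lt hst.1, n4⟩
    refine ⟨hM (x s, δ s) ⟨by simpa [dist_eq_norm] using n2.le, by simpa using hsd⟩, ?_⟩
    -- The state is frozen at `x t`: the increment `x s - x t` counts as noise in the feedback and
    -- as a perturbation in the linear part, so the margin applies at the boundary point.
    have hdec : F (x s) (δ s) = actL matA (x t) +
        actL matB (u (x t + (x s - x t + (δ s).fst))) +
        (actL matA (x s - x t) + (δ s).snd) := by
      rw [hFR _ _ n1, perturbedField, ← actL_apply, ← actL_apply, map_sub,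
        show x t + (x s - x t + (δ s).fst) = x s + (δ s).fst by abel]
      abel
    rw [hdec]
    have hA := (actL matA).le_opNorm (x s - x t)
    have hA0 : 0 ≤ ‖actL matA‖ * ‖x s - x t‖ := by positivity
    refine hrob (β t) hβ hβ1 (x t) _ _ heq ?_ ?_
    · refine (norm_add_le _ _).trans ?_
      linarith [WithLp.norm_fst_le State (δ s)]
    · refine (norm_add_le _ _).trans ?_
      linarith [WithLp.norm_snd_le State (δ s), norm_nonneg (x s - x t)]
  have hae : ∀ z ∈ Ioo t t₁, ∀ᵐ s, s ∈ uIoc t z → ‖F (x s) (δ s)‖ ≤ M ∧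
      inner ℝ (actL P (scale w (β t)⁻¹ (x t))) (scale w (β t)⁻¹ (F (x s) (δ s)))
        ≤ -(ρ / 2) * β t ^ μ * J := by
    intro z hz
    filter_upwards [hmain] with s hs hsz
    rw [uIoc_of_le hz.1.le] at hsz
    exact hs ⟨hsz.1, hsz.2.trans_lt hz.2⟩
  rw [← heq]
  refine eventually_quad_le hD.posDef (D := fun t => scale w (β t)⁻¹) (L := M)
    (κ := -(ρ / 2) * β t ^ μ * J) (hDd t ht.1) ?_ ?_ ?_
  · filter_upwards [Ioo_mem_nhdsGT ht₁] with z hz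
    rw [(hx t z ht.1 hz.1.le (hsub hz).2.2.2.le).2, add_sub_cancel_left]
    have := intervalIntegral.norm_integral_le_of_norm_le_const_ae (a := t) (b := z) (C := M)
      (f := fun s => F (x s) (δ s)) (by filter_upwards [hae z hz] with s hs hsz using (hs hsz).1)
    rwa [abs_of_pos (sub_pos.2 hz.1)] at this
  · filter_upwards [Ioo_mem_nhdsGT ht₁] with z hz
    obtain ⟨hint, heqx⟩ := hx t z ht.1 hz.1.le (hsub hz).2.2.2.le
    rw [heqx, add_sub_cancel_left]
    set ℓ := (innerSL ℝ (actL P (scale w (β t)⁻¹ (x t)))).comp (scale w (β t)⁻¹)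
    change ℓ (∫ s in t..z, F (x s) (δ s)) ≤ _
    rw [← ContinuousLinearMap.intervalIntegral_comp_comm ℓ hint]
    have hi : IntervalIntegrable (fun s => ℓ (F (x s) (δ s))) volume t z :=
      ⟨ℓ.integrable_comp hint.1, ℓ.integrable_comp hint.2⟩
    calc ∫ s in t..z, ℓ (F (x s) (δ s)) ≤ ∫ s in t..z, -(ρ / 2) * β t ^ μ * J := by
          rw [intervalIntegral.integral_of_le hz.1.le, intervalIntegral.integral_of_le hz.1.le]
          refine setIntegral_mono_ae_restrict hi.1 intervalIntegrable_const.1 ?_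
          rw [EventuallyLE, ae_restrict_iff' measurableSet_Ioc, ← uIoc_of_le hz.1.le]
          filter_upwards [hae z hz] with s hs hsz using (hs hsz).2
      _ = _ := by
        rw [intervalIntegral.integral_const, smul_eq_mul, mul_comm]
  · simp only [_root_.smul_apply, _root_.neg_apply, ContinuousLinearMap.comp_apply,
      inner_smul_right, inner_neg_right]
    rw [← hJ]
    have hle : v₀ / (1 + ρ / 4 * v₀ * t) ≤ β t := by simp only [β, envelope]; linarith
    set f := v₀ / (1 + ρ / 4 * v₀ * t)
    have hf0 : 0 < f := hfrac t ht.1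
    have h1 : β t ≤ β t ^ μ := by
      conv_lhs => rw [← Real.rpow_one (β t)]
      exact Real.rpow_le_rpow_of_exponent_ge hβ hβ1 h.degree_lt_one.le
    have h2 : f ^ 2 * (β t)⁻¹ ≤ β t := by
      rw [← div_eq_mul_inv, div_le_iff₀ hβ]
      nlinarith
    have h3 : ρ / 4 * (f ^ 2 * (β t)⁻¹) < ρ / 2 * β t ^ μ := by nlinarith
    nlinarith

end Comparison

/-! ### Functions of class 𝓚 and 𝓚𝓛 -/

section ComparisonFunctions

theorem isClassK_const_mul_rpow {k b : ℝ≥0} (hk : 0 < k) (hb : 0 < b) {a : ℝ≥0 → ℝ≥0}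
    (ha : IsClassK a) : IsClassK fun r => k * a r ^ (b : ℝ) := by
  have hb' : (0 : ℝ) < b := hb
  refine ⟨continuous_const.mul ((NNReal.continuous_rpow_const hb'.le).comp ha.1), ?_, ?_⟩
  · intro r s hrs
    exact mul_lt_mul_of_pos_left (NNReal.rpow_lt_rpow (ha.2.1 hrs) hb') hk
  · simp [ha.2.2, NNReal.zero_rpow hb'.ne']

theorem isClassK_sqrt_mul {c : ℝ≥0} (hc : 0 < c) : IsClassK fun r => NNReal.sqrt (c * r) :=
  ⟨by fun_prop, fun _ _ hrs => NNReal.sqrt_lt_sqrt.2 (mul_lt_mul_of_pos_left hrs hc), by simp⟩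

/-- The solution map of `ṡ = -c s²` composed with functions of class `𝓚` is of class `𝓚𝓛`. -/
theorem isClassKL_riccati {k b c : ℝ≥0} (hk : 0 < k) (hb : 0 < b) (hc : 0 < c) {a : ℝ≥0 → ℝ≥0}
    (ha : IsClassK a) : IsClassKL fun r t => k * (a r / (1 + c * a r * t)) ^ (b : ℝ) := by
  have hb' : (0 : ℝ) < b := hb
  have hden : ∀ s t : ℝ≥0, 0 < 1 + c * s * t := fun s t => by positivity
  refine ⟨?_, fun t => isClassK_const_mul_rpow (a := fun r => a r / (1 + c * a r * t)) hk hb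
    ⟨?_, ?_, ?_⟩, fun r hr => ⟨?_, ?_⟩⟩
  · have h1 : Continuous fun p : ℝ≥0 × ℝ≥0 => a p.1 / (1 + c * a p.1 * p.2) := by
      have := ha.1
      exact Continuous.div₀ (by fun_prop) (by fun_prop) fun p => (hden _ _).ne'
    exact continuous_const.mul ((NNReal.continuous_rpow_const hb'.le).comp h1)
  · have := ha.1
    exact Continuous.div₀ (by fun_prop) (by fun_prop) fun p => (hden _ _).ne'
  · intro r s hrs
    have := ha.2.1 hrs
    -- After cross-multiplication the mixed terms `c * a r * a s * t` agree on both sides.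
    rw [div_lt_div_iff₀ (hden _ _) (hden _ _)]
    calc a r * (1 + c * a s * t) = a r + c * a r * a s * t := by ring
      _ < a s + c * a r * a s * t := by gcongr
      _ = _ := by ring
  · simp [ha.2.2]
  · have har : 0 < a r := by
      have := ha.2.1 hr
      rwa [ha.2.2] at this
    intro t s hts
    refine mul_lt_mul_of_pos_left (NNReal.rpow_lt_rpow ?_ hb') hk
    refine div_lt_div_of_pos_left har (hden _ _) ?_
    gcongr
  · have har : 0 < a r := by
      have := ha.2.1 hr
      rwa [ha.2.2] at this
    have h1 : Tendsto (fun t : ℝ≥0 => a r / (1 + c * a r * t)) atTop (𝓝 0) := by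
      rw [← NNReal.tendsto_coe]
      push_cast
      refine Tendsto.div_atTop (tendsto_const_nhds (x := (a r : ℝ))) ?_
      have hca : (0 : ℝ) < c * a r := by positivity
      exact tendsto_atTop_add_const_left _ _
        ((NNReal.tendsto_coe_atTop.2 tendsto_id).const_mul_atTop hca)
    have h2 := ((NNReal.continuous_rpow_const hb'.le).tendsto 0).comp h1
    rw [NNReal.zero_rpow hb'.ne'] at h2
    simpa using h2.const_mul k

end ComparisonFunctions

/-! ### Extension of flows and absence of jumps -/

section Extension

variable {E W : Type} [NormedAddCommGroup E] [NormedSpace ℝ E] [NormedAddCommGroup W]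

theorem isFlowOn_of_primitive {f : ℝ → E → E} {x : ℝ → E} {T : ℝ}
    (h : ∀ t, 0 ≤ t → t ≤ T → IntervalIntegrable (fun s => f s (x s)) volume 0 t ∧
      x t = x 0 + ∫ s in (0 : ℝ)..t, f s (x s)) : IsFlowOn f T x := by
  intro a b ha hab hb
  obtain ⟨ia, ea⟩ := h a ha (hab.trans hb)
  obtain ⟨ib, eb⟩ := h b (ha.trans hab) hb
  refine ⟨ia.symm.trans ib, ?_⟩
  rw [← intervalIntegral.integral_interval_sub_left ib ia, eb, ea]
  abel

theorem IsFlowOn.congr {f g : ℝ → E → E} {x y : ℝ → E} {T : ℝ} (h : IsFlowOn f T x)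
    (hxy : ∀ t, 0 ≤ t → t ≤ T → x t = y t) (hfg : ∀ t, 0 ≤ t → t ≤ T → f t (x t) = g t (y t)) :
    IsFlowOn g T y := by
  intro a b ha hab hb
  obtain ⟨i, e⟩ := h a b ha hab hb
  have hEq : EqOn (fun s => f s (x s)) (fun s => g s (y s)) (uIcc a b) := by
    intro s hs
    rw [uIcc_of_le hab] at hs
    exact hfg s (ha.trans hs.1) (hs.2.trans hb)
  refine ⟨i.congr (hEq.mono uIoc_subset_uIcc), ?_⟩
  rw [← hxy b (ha.trans hab) hb, ← hxy a ha (hab.trans hb), e, intervalIntegral.integral_congr hEq]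

/-- For a bounded field, a solution on `[0, T)` extends to `[0, ∞)`. -/
theorem exists_flow_extension [FiniteDimensional ℝ E] {F : E → W → E} {δ : ℝ → W} {M T : ℝ}
    {x₀ : E} {x : ℝ → E} (hF : Continuous (Function.uncurry F))
    (hδ : AEStronglyMeasurable δ (volume.restrict (Ioi 0)))
    (hM : ∀ᵐ s ∂(volume.restrict (Ioi 0)), ∀ x, ‖F x (δ s)‖ ≤ M) (hT : 0 ≤ T)
    (hx₀ : 0 < T → x 0 = x₀) (hx : ∀ b < T, IsFlowOn (fun t y => F y (δ t)) b x) :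
    ∃ y : ℝ → E, y 0 = x₀ ∧ (∀ t, 0 ≤ t → t < T → y t = x t) ∧
      ∀ b, IsFlowOn (fun t y => F y (δ t)) b y := by
  have hmeas : AEStronglyMeasurable (fun s => F (x s) (δ s)) (volume.restrict (Ioo 0 T)) := by
    have hxc : ContinuousOn x (Ioo 0 T) := fun t ht => by
      obtain ⟨b, hb⟩ := exists_between ht.2
      exact ((hx b hb.2).continuousOn.continuousAt
        (Icc_mem_nhds ht.1 hb.1)).continuousWithinAt
    exact hF.comp_aestronglyMeasurable ((hxc.aestronglyMeasurable measurableSet_Ioo).prodMk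
      (hδ.mono_measure (Measure.restrict_mono Ioo_subset_Ioi_self le_rfl)))
  have hint : IntegrableOn (fun s => F (x s) (δ s)) (Ioo 0 T) := by
    refine Integrable.of_bound hmeas M ?_
    filter_upwards [ae_mono (Measure.restrict_mono Ioo_subset_Ioi_self le_rfl) hM] with s hs
    exact hs _
  have hsub : Ioi T ⊆ Ioi 0 := Ioi_subset_Ioi hT
  obtain ⟨z, hz, hzT⟩ := exists_forward_solution (t₀ := T)
    (x₀ + ∫ s in Ioo 0 T, F (x s) (δ s)) hF
    (hδ.mono_measure (Measure.restrict_mono hsub le_rfl))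
    (ae_mono (Measure.restrict_mono hsub le_rfl) hM)
  let y : ℝ → E := fun t => if t < T then x t else z t
  have hyx : ∀ t, t < T → y t = x t := fun t ht => if_pos ht
  have hyz : ∀ t, T ≤ t → y t = z t := fun t ht => if_neg ht.not_gt
  have hy0 : y 0 = x₀ := by
    -- For `T = 0` nothing is assumed of `x`, so extension includes plain existence from `x₀`.
    rcases hT.eq_or_lt with rfl | h0
    · rw [hyz 0 le_rfl, (hzT 0 le_rfl).2]; simp
    · rw [hyx 0 h0, hx₀ h0]
  refine ⟨y, hy0, fun t _ ht => hyx t ht, fun b => isFlowOn_of_primitive fun t ht _ => ?_⟩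
  rw [hy0]
  rcases lt_or_ge t T with htT | htT
  · have h1 : IsFlowOn (fun t y => F y (δ t)) t y :=
      (hx t htT).congr (fun s _ hs => (hyx s (hs.trans_lt htT)).symm)
        fun s _ hs => by rw [hyx s (hs.trans_lt htT)]
    have h2 := h1 0 t le_rfl ht le_rfl
    rwa [hy0] at h2
  · have hEq : EqOn (fun s => F (y s) (δ s)) (fun s => F (x s) (δ s)) (Ioo 0 T) := fun s hs => by
      simp only [hyx s hs.2]
    have i1 : IntervalIntegrable (fun s => F (y s) (δ s)) volume 0 T := by
      rw [intervalIntegrable_iff_integrableOn_Ioo_of_le hT]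
      exact hint.congr_fun hEq.symm measurableSet_Ioo
    have hEq2 : EqOn (fun s => F (z s) (δ s)) (fun s => F (y s) (δ s)) (uIcc T t) := fun s hs => by
      rw [uIcc_of_le htT] at hs
      simp only [hyz s hs.1]
    have i2 := (hzT t htT).1.congr (hEq2.mono uIoc_subset_uIcc)
    refine ⟨i1.trans i2, ?_⟩
    rw [← intervalIntegral.integral_add_adjacent_intervals i1 i2, hyz t htT, (hzT t htT).2,
      intervalIntegral.integral_congr hEq2, intervalIntegral.integral_of_le hT,
      integral_Ioc_eq_integral_Ioo, setIntegral_congr_fun measurableSet_Ioo hEq, add_assoc]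

/-- A solution without jumps that stays away from the jump set is a solution of the impulsive
system. -/
theorem isImpulsiveSolution_of_isFlowOn {f : ℝ → E → E} {Ω : Set E} {Φ : E → E} {x : ℝ → E}
    (hx : ∀ b, IsFlowOn f b x) (hΩ : ∀ t, 0 ≤ t → x t ∉ Ω) :
    IsImpulsiveSolution f Ω Φ (x 0) ⊤ x := by
  have hc : ∀ t, 0 < t → ContinuousAt x t := fun t ht =>
    (hx (t + 1)).continuousOn.continuousAt (Icc_mem_nhds ht (lt_add_one t))
  have hl : ∀ t, 0 < t → Function.leftLim x t = x t := fun t ht =>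
    leftLim_eq_of_tendsto ((hc t ht).tendsto.mono_left nhdsWithin_le_nhds)
  refine ⟨rfl, fun t ht _ => ?_,
    fun t ht _ => ⟨x t, (hc t ht).tendsto.mono_left nhdsWithin_le_nhds⟩,
    fun t _ _ => ?_, fun t ht _ h => ?_, fun a b ha hab _ _ => hx b a b ha hab le_rfl⟩
  · refine ((hx (t + 1)).continuousOn t ⟨ht, by linarith⟩).mono_of_mem_nhdsWithin ?_
    filter_upwards [Icc_mem_nhdsGE (lt_add_one t)] with s hs using ⟨ht.trans hs.1, hs.2⟩
  · convert Set.finite_empty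
    rw [eq_empty_iff_forall_notMem]
    rintro s ⟨hs, hs'⟩
    rw [hl s hs.1] at hs'
    exact hΩ s hs.1.le hs'
  · rw [hl t ht] at h
    exact absurd h (hΩ t ht.le)

/-- If flows of the system remain in a closed set disjoint from the jump set, then solutions of the
impulsive system do not jump. -/
theorem IsImpulsiveSolution.isFlowOn {f : ℝ → E → E} {Ω : Set E} {Φ : E → E} {x₀ : E} {T : EReal}
    {x : ℝ → E} (hx : IsImpulsiveSolution f Ω Φ x₀ T x) {K : Set E} (hK : IsClosed K)
    (hKΩ : Disjoint K Ω) (hflow : ∀ b : ℝ, 0 ≤ b → (b : EReal) < T → IsFlowOn f b x → x b ∈ K)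
    {b : ℝ} (hb : (b : EReal) < T) : IsFlowOn f b x := by
  have hno : ∀ t : ℝ, 0 < t → (t : EReal) < T → Function.leftLim x t ∉ Ω := by
    intro t ht htT hjump
    set S := {s : ℝ | s ∈ Ioc 0 t ∧ Function.leftLim x s ∈ Ω}
    have hS : S.Finite := hx.finite_jumps t ht.le htT
    -- Before the first jump the solution is a flow and stays in `K`; closedness puts its left limit
    -- in `K` too, away from `Ω`.
    obtain ⟨s, hsS, hmin⟩ := hS.exists_minimal ⟨t, ⟨ht, le_rfl⟩, hjump⟩
    have hsT : (s : EReal) < T := lt_of_le_of_lt (by exact_mod_cast hsS.1.2) htT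
    have hbefore : ∀ r ∈ Ioo 0 s, x r ∈ K := by
      intro r hr
      have hrT : (r : EReal) < T := lt_trans (by exact_mod_cast hr.2) hsT
      refine hflow r hr.1.le hrT fun a c ha hac hcr => ?_
      refine hx.flow a c ha hac (lt_of_le_of_lt (by exact_mod_cast hcr) hrT) fun q hq hqΩ => ?_
      have hqs : q < s := (hq.2.trans hcr).trans_lt hr.2
      have hqS : q ∈ S := ⟨⟨ha.trans_lt hq.1, hqs.le.trans hsS.1.2⟩, hqΩ⟩
      exact hqs.not_ge (hmin hqS hqs.le)
    obtain ⟨y, hy⟩ := hx.left_lim s hsS.1.1 hsT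
    have hyK : y ∈ K := hK.mem_of_tendsto hy (by
      filter_upwards [Ioo_mem_nhdsLT hsS.1.1] with r hr using hbefore r hr)
    have hl : Function.leftLim x s = y := leftLim_eq_of_tendsto hy
    exact disjoint_left.1 hKΩ hyK (hl ▸ hsS.2)
  intro a c ha hac hcb
  have hcT : (c : EReal) < T := lt_of_le_of_lt (by exact_mod_cast hcb) hb
  exact hx.flow a c ha hac hcT fun s hs =>
    hno s (ha.trans_lt hs.1) (lt_of_le_of_lt (by exact_mod_cast hs.2) hcT)

end Extension

/-! ### Essential suprema of the input -/

section EssentialBounds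

variable {W : Type} [NormedAddCommGroup W]

theorem ae_norm_le_supNorm {δ : ℝ → W} {S : Set ℝ} (hδ : MemLp δ ∞ (volume.restrict S)) :
    ∀ᵐ s ∂(volume.restrict S), ‖δ s‖ ≤ supNorm δ S := by
  have h1 := ae_le_eLpNormEssSup (f := δ) (μ := volume.restrict S)
  filter_upwards [h1] with s hs
  rw [← eLpNorm_exponent_top] at hs
  have h2 := ENNReal.toNNReal_mono hδ.2.ne hs
  rw [supNorm]
  exact_mod_cast h2

theorem supNorm_mono {δ : ℝ → W} {S S' : Set ℝ} (hS : S ⊆ S')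
    (hδ : MemLp δ ∞ (volume.restrict S')) : supNorm δ S ≤ supNorm δ S' :=
  ENNReal.toNNReal_mono hδ.2.ne (eLpNorm_mono_measure δ (Measure.restrict_mono hS le_rfl))

end EssentialBounds

/-! ### Truncation by radial retraction -/

/-- The radial retraction onto the ball of radius `R`. -/
def radialRetraction {E : Type} [NormedAddCommGroup E] [NormedSpace ℝ E] (R : ℝ) (x : E) : E :=
  (R / max R ‖x‖) • x

section Retraction

variable {E : Type} [NormedAddCommGroup E] [NormedSpace ℝ E] {R : ℝ}

theorem continuous_radialRetraction (hR : 0 < R) :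
    Continuous (radialRetraction R : E → E) := by
  have : ∀ x : E, max R ‖x‖ ≠ 0 := fun x => (lt_max_of_lt_left hR).ne'
  unfold radialRetraction
  fun_prop (disch := assumption)

theorem norm_radialRetraction_le (hR : 0 < R) (x : E) : ‖radialRetraction R x‖ ≤ R := by
  have h1 : 0 < max R ‖x‖ := lt_max_of_lt_left hR
  rw [radialRetraction, norm_smul, Real.norm_eq_abs, abs_of_pos (by positivity), div_mul_eq_mul_div,
    div_le_iff₀ h1]
  exact mul_le_mul_of_nonneg_left (le_max_right _ _) hR.le

theorem radialRetraction_of_norm_lt {x : E} (hx : ‖x‖ < R) :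
    radialRetraction R x = x := by
  have hR : R ≠ 0 := ((norm_nonneg x).trans_lt hx).ne'
  rw [radialRetraction, max_eq_left hx.le, div_self hR, one_smul]

end Retraction

/-- The form `ξᵀ Hᵀ H ξ` is the squared norm of the angle part alone. -/
theorem pi_le_norm_of_mem_jumpSet {ξ : State} (hξ : ξ ∈ jumpSet) : Real.pi ≤ ‖ξ‖ := by
  have h1 := hξ.1
  have h2 : ξ.ofLp ⬝ᵥ ((matHᵀ * matH) *ᵥ ξ.ofLp) ≤ ‖ξ‖ ^ 2 := by
    rw [EuclideanSpace.norm_sq_eq, dotProduct, Fintype.sum_sum_type, Fintype.sum_sum_type]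
    have : matHᵀ * matH = fromBlocks 1 0 0 0 := by
      simp [matH, fromBlocks_transpose, fromBlocks_multiply]
    rw [this]
    simp [mulVec, dotProduct, Fintype.sum_sum_type, Matrix.one_apply, ← sq]
    positivity
  rw [h1] at h2
  exact (pow_le_pow_iff_left₀ Real.pi_pos.le (norm_nonneg _) two_ne_zero).1 h2

/-! ### The flow estimate and local input-to-state stability -/

section LocalStability

variable {μ ρ : ℝ} {G₀ : Matrix Ix Ix ℝ} {Y₀ : Matrix (Fin 3) Ix ℝ} {X : Matrix Ix Ix ℝ}
  {Y : Matrix (Fin 3) Ix ℝ}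

theorem continuous_perturbedField {u : State → EuclideanSpace ℝ (Fin 3)} (hu : Continuous u) :
    Continuous (Function.uncurry (perturbedField u)) := by
  have h1 : Continuous fun p : State × Disturbance => p.2.fst :=
    (WithLp.prod_continuous_ofLp 2 State State).fst.comp continuous_snd
  have h2 : Continuous fun p : State × Disturbance => p.2.snd :=
    (WithLp.prod_continuous_ofLp 2 State State).snd.comp continuous_snd
  exact (((actL matA).continuous.comp continuous_fst).add
    ((actL matB).continuous.comp (hu.comp (continuous_fst.add h1)))).add h2

/-- The quantitative estimate for flows of a field that agrees with the closed loop on the unit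
ball. -/
theorem IsHomogeneousDesign.exists_flow_estimate
    (h : IsHomogeneousDesign matA matB μ ρ G₀ Y₀ X Y) (hμ : -1 < μ) :
    ∃ (β : ℝ≥0 → ℝ≥0 → ℝ≥0) (γ : ℝ≥0 → ℝ≥0), IsClassKL β ∧ IsClassK γ ∧
      ∃ rx : ℝ≥0, 0 < rx ∧ ∃ rδ : ℝ≥0, 0 < rδ ∧
        ∀ F : State → Disturbance → State, Continuous (Function.uncurry F) →
          (∀ x w, ‖x‖ < 1 →
            F x w = perturbedField (homFeedback μ (diagonal (weight μ)) X Y) x w) →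
          ∀ (δ : ℝ → Disturbance) (x : ℝ → State) (t d : ℝ≥0), ‖x 0‖₊ < rx → d < rδ →
            (∀ᵐ s ∂(volume.restrict (Ioo 0 (t : ℝ))), ‖δ s‖ ≤ d) →
            IsFlowOn (fun t y => F y (δ t)) t x →
            ‖x t‖₊ ≤ β ‖x 0‖₊ t + γ d ∧ ‖x t‖ < 1 := by
  have hρ := h.rate_pos
  have hD := h.isMonotoneDilation hμ
  have hμ1 := h.degree_lt_one
  obtain ⟨η, hη, hrob⟩ := h.exists_robustnessMargin hμ
  obtain ⟨c, hc, hcq⟩ := le_quad hD.posDef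
  obtain ⟨C, hC, hCq⟩ := quad_le X⁻¹
  -- Since `-1 < μ < 1`, this lies in `(0, 1]` and below both weights; `b ≤ 1` later gives
  -- subadditivity of `s ^ b`.
  set b := (1 - μ) / 2 with hb
  have hb0 : 0 < b := by rw [hb]; linarith
  have hb1 : b ≤ 1 := by rw [hb]; linarith
  have hlow : ∀ (v : ℝ) (y : State), 0 < v → v ≤ 1 →
      quad X⁻¹ (scale (weight μ) v⁻¹ y) ≤ 1 → ‖y‖ ≤ c⁻¹ * v ^ b := by
    intro v y hv hv1 hq
    have h1 := norm_scale_le_of_le_one (le_weight hμ hμ1) hv hv1 (scale (weight μ) v⁻¹ y)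
    rw [scale_scale_inv _ hv] at h1
    have h2 : ‖scale (weight μ) v⁻¹ y‖ ≤ c⁻¹ := by
      have h3 := (hcq _).trans hq
      rw [sq_le_one_iff₀ (by positivity)] at h3
      rwa [inv_eq_one_div c, le_div_iff₀ hc, mul_comm]
    calc ‖y‖ ≤ v ^ b * ‖scale (weight μ) v⁻¹ y‖ := h1
      _ ≤ v ^ b * c⁻¹ := by gcongr
      _ = _ := mul_comm _ _
  have hup : ∀ (v : ℝ) (y : State), 0 < v → v ≤ 1 → C * ‖y‖ ≤ v ^ 2 →
      quad X⁻¹ (scale (weight μ) v⁻¹ y) ≤ 1 := by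
    intro v y hv hv1 hy
    refine (hCq _).trans (pow_le_one₀ (by positivity) ?_)
    have h1 := norm_scale_inv_le_of_le_one (weight_le_two hμ) hv hv1 y
    rw [Real.rpow_two] at h1
    calc C * ‖scale (weight μ) v⁻¹ y‖ ≤ C * (v⁻¹ ^ 2 * ‖y‖) := by gcongr
      _ = v⁻¹ ^ 2 * (C * ‖y‖) := by ring
      _ ≤ v⁻¹ ^ 2 * v ^ 2 := by gcongr
      _ = 1 := by field_simp
  obtain ⟨v, hv, hv1, hvb⟩ : ∃ v : ℝ, 0 < v ∧ v ≤ 1 ∧ c⁻¹ * v ^ b < 1 := by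
    have hlim : Tendsto (fun v : ℝ => c⁻¹ * v ^ b) (𝓝[>] 0) (𝓝 0) := by
      have := ((Real.continuous_rpow_const hb0.le).tendsto 0).const_mul c⁻¹
      rw [Real.zero_rpow hb0.ne', mul_zero] at this
      exact this.mono_left nhdsWithin_le_nhds
    obtain ⟨v, h1, h2⟩ := ((hlim.eventually (gt_mem_nhds one_pos)).and
      (Ioc_mem_nhdsGT one_pos)).exists
    exact ⟨v, h2.1, h2.2, h1⟩
  lift c to ℝ≥0 using hc.le
  lift C to ℝ≥0 using hC.le
  lift η to ℝ≥0 using hη.le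
  lift ρ to ℝ≥0 using hρ.le
  lift v to ℝ≥0 using hv.le
  have hc' : 0 < c := by exact_mod_cast hc
  have hC' : 0 < C := by exact_mod_cast hC
  have hη' : 0 < η := by exact_mod_cast hη
  have hρ' : 0 < ρ := by exact_mod_cast hρ
  have hv' : 0 < v := by exact_mod_cast hv
  have hbN : 0 < (⟨b, hb0.le⟩ : ℝ≥0) := hb0
  -- This fixes the radii: both `√(C ‖x 0‖)` and `√(d / η)` must be below `v / 4`, so the tube
  -- starts inside homogeneous radius `v`.
  have hsqrt : ∀ a r : ℝ≥0, 0 < a → r < v ^ 2 / (16 * a) → √((a : ℝ) * r) < v / 4 := by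
    intro a r ha hr
    rw [Real.sqrt_lt' (by positivity)]
    rw [lt_div_iff₀ (by positivity)] at hr
    have hr' : (r : ℝ) * (16 * a) < v ^ 2 := by exact_mod_cast hr
    nlinarith
  refine ⟨fun r t => c⁻¹ * (NNReal.sqrt (C * r) / (1 + ρ / 4 * NNReal.sqrt (C * r) * t)) ^ b,
    fun d => c⁻¹ * NNReal.sqrt (η⁻¹ * d) ^ b,
    isClassKL_riccati (b := ⟨b, hb0.le⟩) (by positivity) hbN (by positivity)
      (isClassK_sqrt_mul hC'),
    isClassK_const_mul_rpow (b := ⟨b, hb0.le⟩) (by positivity) hbN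
      (isClassK_sqrt_mul (by positivity)),
    v ^ 2 / (16 * C), by positivity, v ^ 2 / (16 * η⁻¹), by positivity, ?_⟩
  intro F hF hFR δ x t d hx₀ hd hδ hflow
  set χ : ℝ := √((η⁻¹ : ℝ≥0) * d) with hχdef
  set a : ℝ := √(C * ‖x 0‖) with hadef
  have hχ : χ < v / 4 := hsqrt _ _ (by positivity) hd
  have ha : a < v / 4 := hsqrt C ‖x 0‖₊ hC' hx₀
  have hχ0 : 0 ≤ χ := Real.sqrt_nonneg _
  have ha0 : 0 ≤ a := Real.sqrt_nonneg _
  have hdχ : (d : ℝ) ≤ η * χ ^ 2 := by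
    rw [hχdef, Real.sq_sqrt (by positivity)]
    push_cast
    rw [mul_inv_cancel_left₀ hη.ne']
  -- The envelope needs a positive initial radius although `x 0` may vanish; `ε` is sent to `0`
  -- afterwards.
  have key : ∀ ε ∈ Ioo (0 : ℝ) (v / 2),
      ‖x t‖ ≤ (c : ℝ)⁻¹ * envelope (ρ / 4) (a + ε) χ t ^ b ∧ ‖x t‖ < 1 := by
    intro ε hε
    have hε0 := hε.1
    have hsum : a + ε + χ ≤ v := by linarith [hε.2]
    have hpos : 0 < a + ε + χ := by positivity
    have hR : ∀ (s : ℝ) (y : State), 0 < s → s ≤ a + ε + χ →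
        quad X⁻¹ (scale (weight μ) s⁻¹ y) ≤ 1 → ‖y‖ < 1 := by
      intro s y hs hsv hq
      refine (hlow s y hs (by linarith) hq).trans_lt (lt_of_le_of_lt ?_ hvb)
      gcongr
      exact hsv.trans hsum
    have hq := h.quad_scale_envelope_le_one hμ hη hrob hF hFR hδ hflow (v₀ := a + ε) (by positivity)
      hχ0 (hsum.trans hv1) hdχ (hup _ _ hpos (hsum.trans hv1) (by
        have : (C : ℝ) * ‖x 0‖ = a ^ 2 := by rw [hadef, Real.sq_sqrt (by positivity)]
        rw [this]
        gcongr
        linarith)) hR (t := t) ⟨t.2, le_rfl⟩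
    have hbpos : 0 < envelope (ρ / 4) (a + ε) χ t := by
      unfold envelope; positivity
    have hble : envelope (ρ / 4) (a + ε) χ t ≤ a + ε + χ := by
      unfold envelope
      have : (a + ε) / (1 + ρ / 4 * (a + ε) * t) ≤ a + ε := div_le_self (by positivity)
        (le_add_of_nonneg_right (by positivity))
      linarith
    exact ⟨hlow _ _ hbpos (by linarith) hq, hR _ _ hbpos hble hq⟩
  refine ⟨?_, (key (v / 4) ⟨by positivity, by linarith⟩).2⟩
  have hden : (1 + (ρ : ℝ) / 4 * a * t) ≠ 0 := by positivity
  have hlim : Tendsto (fun ε => (c : ℝ)⁻¹ * envelope (ρ / 4) (a + ε) χ t ^ b) (𝓝[>] 0)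
      (𝓝 ((c : ℝ)⁻¹ * (a / (1 + ρ / 4 * a * t) + χ) ^ b)) := by
    have hcont : ContinuousAt (fun ε : ℝ => (c : ℝ)⁻¹ *
        ((a + ε) / (1 + ρ / 4 * (a + ε) * t) + χ) ^ b) 0 := by
      refine continuousAt_const.mul (ContinuousAt.rpow_const (ContinuousAt.add
        (ContinuousAt.div (by fun_prop) (by fun_prop) (by simpa using hden)) continuousAt_const)
        (Or.inr hb0.le))
    have := hcont.tendsto
    simp only [add_zero] at this
    exact this.mono_left nhdsWithin_le_nhds
  have hle : ‖x t‖ ≤ (c : ℝ)⁻¹ * (a / (1 + ρ / 4 * a * t) + χ) ^ b := by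
    refine ge_of_tendsto hlim ?_
    filter_upwards [Ioo_mem_nhdsGT (show (0 : ℝ) < v / 2 by positivity)] with ε hε
    exact (key ε hε).1
  -- Subadditivity of the power separates the initial state from the disturbance.
  have hadd : (a / (1 + ρ / 4 * a * t) + χ) ^ b ≤ (a / (1 + ρ / 4 * a * t)) ^ b + χ ^ b :=
    Real.rpow_add_le_add_rpow (by positivity) hχ0 hb0.le hb1
  rw [← NNReal.coe_le_coe]
  push_cast
  calc ‖x t‖ ≤ _ := hle
    _ ≤ (c : ℝ)⁻¹ * ((a / (1 + ρ / 4 * a * t)) ^ b + χ ^ b) := by gcongr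
    _ = _ := by rw [mul_add]; simp [hadef, hχdef]

/-- A system with continuous right-hand side is locally input-to-state stable if there are
comparison functions that bound the flows of all fields that agree with it on the unit ball, and
this ball contains no jump points. -/
theorem isLocallyISS_of_flow_estimate {E W : Type} [NormedAddCommGroup E] [NormedSpace ℝ E]
    [FiniteDimensional ℝ E] [NormedAddCommGroup W] [ProperSpace W] {F : E → W → E} {Ω : Set E}
    {Φ : E → E} (hF : Continuous (Function.uncurry F)) (hΩ : ∀ ξ : E, ‖ξ‖ ≤ 1 → ξ ∉ Ω)
    (hest : ∃ (β : ℝ≥0 → ℝ≥0 → ℝ≥0) (γ : ℝ≥0 → ℝ≥0), IsClassKL β ∧ IsClassK γ ∧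
      ∃ rx : ℝ≥0, 0 < rx ∧ ∃ rδ : ℝ≥0, 0 < rδ ∧
        ∀ F₁ : E → W → E, Continuous (Function.uncurry F₁) →
          (∀ x w, ‖x‖ < 1 → F₁ x w = F x w) →
          ∀ (δ : ℝ → W) (x : ℝ → E) (t d : ℝ≥0), ‖x 0‖₊ < rx → d < rδ →
            (∀ᵐ s ∂(volume.restrict (Ioo 0 (t : ℝ))), ‖δ s‖ ≤ d) →
            IsFlowOn (fun t y => F₁ y (δ t)) t x →
            ‖x t‖₊ ≤ β ‖x 0‖₊ t + γ d ∧ ‖x t‖ < 1) :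
    IsLocallyISS F Ω Φ := by
  obtain ⟨β, γ, hβ, hγ, rx, hrx, rδ, hrδ, hest⟩ := hest
  refine ⟨β, γ, hβ, hγ, rx, hrx, rδ, hrδ, fun x₀ hx₀ δ hδ hδr => ?_⟩
  have hδt : ∀ t : ℝ≥0, ∀ᵐ s ∂(volume.restrict (Ioo 0 (t : ℝ))),
      ‖δ s‖ ≤ supNorm δ (Ioo 0 (t : ℝ)) := fun t =>
    ae_norm_le_supNorm (hδ.mono_measure (Measure.restrict_mono Ioo_subset_Ioi_self le_rfl))
  have hδle : ∀ t : ℝ≥0, supNorm δ (Ioo 0 (t : ℝ)) < rδ := fun t =>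
    (supNorm_mono Ioo_subset_Ioi_self hδ).trans_lt hδr
  -- Composing with the retraction makes the field bounded along `δ`; the estimate keeps flows of
  -- `F₁` in the unit ball, where it agrees with `F`.
  let F₁ : E → W → E := fun x w => F (radialRetraction 1 x) w
  have hF₁ : Continuous (Function.uncurry F₁) := hF.comp
    (((continuous_radialRetraction one_pos).comp continuous_fst).prodMk continuous_snd)
  have hF₁F : ∀ x w, ‖x‖ < 1 → F₁ x w = F x w := fun x w hx => by
    simp only [F₁, radialRetraction_of_norm_lt hx]
  have : ProperSpace E := FiniteDimensional.proper ℝ E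
  obtain ⟨M, hM⟩ := ((isCompact_closedBall (0 : E) 1).prod
    (isCompact_closedBall (0 : W) rδ)).exists_bound_of_continuousOn hF.continuousOn
  have hM₁ : ∀ᵐ s ∂(volume.restrict (Ioi 0)), ∀ x, ‖F₁ x (δ s)‖ ≤ M := by
    filter_upwards [ae_norm_le_supNorm hδ] with s hs x
    refine hM (radialRetraction 1 x, δ s) ⟨?_, ?_⟩
    · simpa using norm_radialRetraction_le one_pos x
    · have : (supNorm δ (Ioi 0) : ℝ) ≤ rδ := by exact_mod_cast hδr.le
      simpa using hs.trans this
  have hext : ∀ (T : ℝ) (x : ℝ → E), 0 ≤ T → (0 < T → x 0 = x₀) →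
      (∀ b < T, IsFlowOn (fun t y => F y (δ t)) b x) →
      ∃ y, IsImpulsiveSolution (fun t y => F y (δ t)) Ω Φ x₀ ⊤ y ∧
        ∀ t : ℝ, 0 ≤ t → t < T → y t = x t := by
    intro T x hT hx0 hx
    have hx1 : ∀ t : ℝ≥0, (t : ℝ) < T → ‖x t‖ < 1 := fun t ht => by
      have h0 : x 0 = x₀ := hx0 (t.2.trans_lt ht)
      exact (hest F hF (fun _ _ _ => rfl) δ x t _ (by rwa [h0]) (hδle t) (hδt t) (hx t ht)).2
    obtain ⟨y, hy0, hyx, hy⟩ := exists_flow_extension (x₀ := x₀) hF₁ hδ.1 hM₁ hT hx0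
      fun b hb => (hx b hb).congr (fun _ _ _ => rfl) fun t ht htb =>
        (hF₁F _ _ (hx1 ⟨t, ht⟩ (htb.trans_lt hb))).symm
    have hy1 : ∀ t, 0 ≤ t → ‖y t‖ < 1 := fun t ht =>
      (hest F₁ hF₁ hF₁F δ y ⟨t, ht⟩ _ (by rwa [hy0]) (hδle _) (hδt _) (hy t)).2
    refine ⟨y, ?_, hyx⟩
    rw [← hy0]
    exact isImpulsiveSolution_of_isFlowOn (fun b => (hy b).congr (fun _ _ _ => rfl)
      fun t ht _ => hF₁F _ _ (hy1 t ht)) fun t ht => hΩ _ (hy1 t ht).le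
  refine ⟨?_, fun T hT x hx => ?_⟩
  -- Existence is the case `T = 0` of extension, with vacuous flow hypotheses.
  · obtain ⟨y, hy, -⟩ := hext 0 (fun _ => x₀) le_rfl (fun _ => rfl) fun b hb a c ha hac hcb =>
      absurd (ha.trans (hac.trans hcb)) (not_le.2 hb)
    exact ⟨y, hy⟩
  have hflow : ∀ b : ℝ, (b : EReal) < T → IsFlowOn (fun t y => F y (δ t)) b x := fun b hb =>
    hx.isFlowOn (Metric.isClosed_closedBall (x := (0 : E)) (ε := 1))
      (disjoint_left.2 fun ξ hξ => hΩ ξ (by simpa using hξ))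
      (fun b hb0 _ hfb => by
        rw [mem_closedBall_zero_iff]
        exact (hest F hF (fun _ _ _ => rfl) δ x ⟨b, hb0⟩ _ (by rwa [hx.init]) (hδle _)
          (hδt _) hfb).2.le) hb
  refine ⟨fun t ht => ?_, ?_⟩
  · have := (hest F hF (fun _ _ _ => rfl) δ x t _ (by rwa [hx.init]) (hδle t) (hδt t)
      (hflow t ht)).1
    rwa [hx.init] at this
  · induction T with
    | bot => exact absurd hT (by simp)
    | top => exact ⟨x, hx, fun _ _ _ => rfl⟩
    | coe T =>
      obtain ⟨y, hy, hyx⟩ := hext T x (by exact_mod_cast hT.le) (fun _ => hx.init)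
        fun b hb => hflow b (by exact_mod_cast hb)
      exact ⟨y, hy, fun t ht htT => hyx t ht (by exact_mod_cast htT)⟩

end LocalStability

end ImpulsiveAttitude

end

theorem corollary2 (μ ρ : ℝ)
    (G₀ : Matrix ImpulsiveAttitude.Ix ImpulsiveAttitude.Ix ℝ)
    (Y₀ : Matrix (Fin 3) ImpulsiveAttitude.Ix ℝ)
    (X : Matrix ImpulsiveAttitude.Ix ImpulsiveAttitude.Ix ℝ)
    (Y : Matrix (Fin 3) ImpulsiveAttitude.Ix ℝ)
    (hdesign : ImpulsiveAttitude.IsHomogeneousDesign ImpulsiveAttitude.matA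
      ImpulsiveAttitude.matB μ ρ G₀ Y₀ X Y)
    (hμ : ImpulsiveAttitude.IsAntiHurwitz
      (μ • (1 : Matrix ImpulsiveAttitude.Ix ImpulsiveAttitude.Ix ℝ)
        + ImpulsiveAttitude.generator μ G₀)) :
    ImpulsiveAttitude.IsLocallyISS
      (ImpulsiveAttitude.perturbedField
        (ImpulsiveAttitude.homFeedback μ (ImpulsiveAttitude.generator μ G₀) X Y))
      ImpulsiveAttitude.jumpSet
      (ImpulsiveAttitude.act ImpulsiveAttitude.matPi) := by
  have hμ' := hdesign.neg_one_lt_degree hμ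
  have : ProperSpace ImpulsiveAttitude.Disturbance :=
    FiniteDimensional.proper ℝ ImpulsiveAttitude.Disturbance
  rw [hdesign.generator_eq_diagonal]
  refine ImpulsiveAttitude.isLocallyISS_of_flow_estimate
    (ImpulsiveAttitude.continuous_perturbedField (ImpulsiveAttitude.continuous_homFeedback
      (hdesign.isMonotoneDilation hμ') Y hμ'))
    (fun ξ hξ hmem => ?_) (hdesign.exists_flow_estimate hμ')
  linarith [ImpulsiveAttitude.pi_le_norm_of_mem_jumpSet hmem, Real.pi_gt_three]
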